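/- Let $n\ge 0$, let $\Gamma\subset\mathbb{C}^n$ be a lattice (a discrete subgroup spanning $\mathbb{C}^n$ over $\mathbb{R}$), and let $\alpha:\mathbb{C}^n\to\mathbb{C}^*$ be a $C^\infty$ character, i.e. a smooth group homomorphism from the additive group $\mathbb{C}^n$ to $\mathbb{C}^*$ (not necessarily unitary or holomorphic). Let $L_\alpha=(\mathbb{C}^n\times\mathbb{C})/\Gamma$ be the holomorphic line bundle over the complex torus $\mathbb{C}^n/\Gamma$ given by the action $\gamma\cdot(z,v)=(z+\gamma,\alpha(\gamma)v)$ of $\Gamma$. If $L_\alpha$ is non-trivial as a holomorphic line bundle, i.e. not holomorphically isomorphic to the product bundle $(\mathbb{C}^n/\Gamma)\times\mathbb{C}$, then for all $p,q\ge 0$ the Dolbeault cohomology with values in $L_\alpha$ vanishes: $$H^{p,q}_{\bar\partial}(\mathbb{C}^n/\Gamma,L_\alpha)=\frac{\ker\bigl(\bar\partial:A^{p,q}(\mathbb{C}^n/\Gamma,L_\alpha)\to A^{p,q+1}(\mathbb{C}^n/\Gamma,L_\alpha)\bigr)}{\bar\partial A^{p,q-1}(\mathbb{C}^n/\Gamma,L_\alpha)}=0,$$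 where $A^{p,q}(\mathbb{C}^n/\Gamma,L_\alpha)$ is the space of smooth $L_\alpha$-valued differential forms of type $(p,q)$, and $A^{p,-1}=0$. -/

import Mathlib

open scoped ContDiff

noncomputable section

namespace ComplexTorus

/-- The complex vector space `ℂⁿ`. -/
abbrev Cn (n : ℕ) : Type := Fin n → ℂ

/-- The complex torus `ℂⁿ/Γ`. Its complex structure is the one for which the projection
`proj Γ : ℂⁿ → ℂⁿ/Γ` is a local biholomorphism; its tangent space at each point is `ℂⁿ`,
through the differential of the projection (this does not depend on the choice of the
point above, since `Γ` acts by translations). -/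
abbrev Torus {n : ℕ} (Γ : Submodule ℤ (Cn n)) : Type := Cn n ⧸ Γ

/-- The projection `ℂⁿ → ℂⁿ/Γ`. -/
def proj {n : ℕ} (Γ : Submodule ℤ (Cn n)) (z : Cn n) : Torus Γ := Submodule.Quotient.mk z

section Bundle

variable {n : ℕ} (Γ : Submodule ℤ (Cn n)) (α : AddChar (Cn n) ℂ)

/-- The orbit relation of the action `γ · (z, v) = (z + γ, α(γ) v)` of `Γ` on `ℂⁿ × ℂ`. -/
def orbitSetoid : Setoid (Cn n × ℂ) where
  r a b := ∃ γ ∈ Γ, b = (a.1 + γ, α γ * a.2)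
  iseqv :=
    { refl := fun a => ⟨0, Γ.zero_mem, by simp⟩
      symm := by
        rintro ⟨z, v⟩ _ ⟨γ, hγ, rfl⟩
        refine ⟨-γ, Γ.neg_mem hγ, ?_⟩
        have h : α (-γ) * α γ = 1 := by rw [← AddChar.map_add_eq_mul]; simp
        simp [← mul_assoc, h]
      trans := by
        rintro ⟨z, v⟩ _ _ ⟨γ, hγ, rfl⟩ ⟨δ, hδ, rfl⟩
        refine ⟨γ + δ, Γ.add_mem hγ hδ, ?_⟩
        simp [AddChar.map_add_eq_mul, add_assoc, mul_left_comm, mul_comm] }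

/-- The total space `L_α = (ℂⁿ × ℂ_α)/Γ`. -/
def TotalSpace : Type := Quotient (orbitSetoid Γ α)

/-- The class `[z, v] ∈ L_α` of `(z, v) ∈ ℂⁿ × ℂ`. -/
def cls (z : Cn n) (v : ℂ) : TotalSpace Γ α := Quotient.mk (orbitSetoid Γ α) (z, v)

/-- The bundle projection `L_α → ℂⁿ/Γ`, `[z, v] ↦ [z]`. -/
def bundleProj : TotalSpace Γ α → Torus Γ :=
  Quotient.lift (fun a : Cn n × ℂ => proj Γ a.1) (by
    rintro ⟨z, v⟩ _ ⟨γ, hγ, rfl⟩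
    refine (Submodule.Quotient.eq Γ).2 ?_
    simpa using Γ.neg_mem hγ)

/-- The fibre of `L_α` over a point of the torus. -/
def Fiber (x : Torus Γ) : Type := {e : TotalSpace Γ α // bundleProj Γ α e = x}

variable {Γ}

/-- For `z` above `x`, the map `v ↦ [z, v]` from `ℂ` to the fibre of `L_α` over `x`. -/
def frameFun {x : Torus Γ} (z : Cn n) (hz : proj Γ z = x) (v : ℂ) : Fiber Γ α x :=
  ⟨cls Γ α z v, hz⟩

theorem exists_mem_of_proj_eq {z w : Cn n} (h : proj Γ z = proj Γ w) :
    ∃ γ ∈ Γ, w = z + γ :=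
  ⟨w - z, (Submodule.Quotient.eq Γ).1 h.symm, by abel⟩

theorem frameFun_add {x : Torus Γ} (z γ : Cn n) (hγ : γ ∈ Γ) (hz : proj Γ z = x)
    (hz' : proj Γ (z + γ) = x) (v : ℂ) :
    frameFun α (z + γ) hz' (α γ * v) = frameFun α z hz v :=
  Subtype.ext (Quotient.sound ((orbitSetoid Γ α).symm ⟨γ, hγ, rfl⟩))

theorem frameFun_bijective {x : Torus Γ} (z : Cn n) (hz : proj Γ z = x) :
    Function.Bijective (frameFun α z hz) := by
  constructor
  · intro v w h
    have h' : cls Γ α z v = cls Γ α z w := congrArg Subtype.val h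
    obtain ⟨γ, -, h2⟩ := Quotient.exact h'
    have h3 : z = z + γ := congrArg Prod.fst h2
    have h4 : w = α γ * v := congrArg Prod.snd h2
    have h5 : γ = 0 := by simpa using h3
    simp [h4, h5]
  · rintro ⟨e, he⟩
    induction e using Quotient.inductionOn with
    | h a =>
      obtain ⟨y, u⟩ := a
      have hy : proj Γ y = x := he
      obtain ⟨γ, hγ, rfl⟩ := exists_mem_of_proj_eq (hy.trans hz.symm)
      exact ⟨α γ * u, frameFun_add α y γ hγ hy hz u⟩

/-- For `z` above `x`, the bijection `v ↦ [z, v]` of `ℂ` onto the fibre of `L_α` over `x`. -/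
def frameEquiv {x : Torus Γ} (z : Cn n) (hz : proj Γ z = x) : ℂ ≃ Fiber Γ α x :=
  Equiv.ofBijective (frameFun α z hz) (frameFun_bijective α z hz)

/-- A point of `ℂⁿ` above a given point of the torus. -/
def rep (x : Torus Γ) : Cn n := (Submodule.mkQ_surjective Γ x).choose

theorem proj_rep (x : Torus Γ) : proj Γ (rep x) = x :=
  (Submodule.mkQ_surjective Γ x).choose_spec

/- The vector space structure and the topology of a fibre are those for which `v ↦ [z, v]` is an
isomorphism for one, equivalently (see `frame` below) for every point `z` above the base point. -/
instance (x : Torus Γ) : AddCommGroup (Fiber Γ α x) :=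
  (frameEquiv α (rep x) (proj_rep x)).symm.addCommGroup

instance (x : Torus Γ) : Module ℂ (Fiber Γ α x) :=
  (frameEquiv α (rep x) (proj_rep x)).symm.module ℂ

instance (x : Torus Γ) : Module ℝ (Fiber Γ α x) := Module.complexToReal _

instance (x : Torus Γ) : TopologicalSpace (Fiber Γ α x) :=
  (frameEquiv α (rep x) (proj_rep x)).symm.topologicalSpace

/-- The isomorphism `v ↦ [z, v]` for the chosen point `z` above `x`. -/
def repFrame (x : Torus Γ) : ℂ ≃L[ℂ] Fiber Γ α x :=
  ((frameEquiv α (rep x) (proj_rep x)).symm.continuousLinearEquiv ℂ).symm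

theorem repFrame_apply (x : Torus Γ) (v : ℂ) :
    repFrame α x v = frameFun α (rep x) (proj_rep x) v := rfl

instance (x : Torus Γ) : IsTopologicalAddGroup (Fiber Γ α x) :=
  (repFrame α x).symm.toHomeomorph.isInducing.topologicalAddGroup (repFrame α x).symm

instance (x : Torus Γ) : ContinuousSMul ℂ (Fiber Γ α x) :=
  (repFrame α x).symm.toHomeomorph.isInducing.continuousSMul continuous_id
    (map_smul (repFrame α x).symm _ _)

theorem frameFun_eq_repFrame {x : Torus Γ} (z : Cn n) (hz : proj Γ z = x) (v : ℂ) :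
    frameFun α z hz v = repFrame α x (α (rep x - z) * v) := by
  have hγ : rep x - z ∈ Γ :=
    (Submodule.Quotient.eq Γ).1 ((proj_rep x).trans hz.symm)
  rw [repFrame_apply]
  have key : ∀ (w : Cn n) (hw : proj Γ w = x), w = z + (rep x - z) →
      frameFun α w hw (α (rep x - z) * v) = frameFun α z hz v := by
    rintro w hw rfl
    exact frameFun_add α z _ hγ hz hw v
  exact (key _ _ (by abel)).symm

/-- The frame of `L_α` at `x` given by a point `z` above `x`: the isomorphism `v ↦ [z, v]` of `ℂ`
onto the fibre over `x`. For `z` varying in a small open set this is a local holomorphic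
trivialization of `L_α`. -/
def frame {x : Torus Γ} (z : Cn n) (_hz : proj Γ z = x) : ℂ ≃L[ℂ] Fiber Γ α x :=
  (ContinuousLinearEquiv.unitsEquivAut ℂ (α.val_isUnit (rep x - z)).unit).trans (repFrame α x)

theorem frame_apply {x : Torus Γ} (z : Cn n) (hz : proj Γ z = x) (v : ℂ) :
    frame α z hz v = frameFun α z hz v := by
  rw [frameFun_eq_repFrame]
  simp [frame, mul_comm]

theorem frame_symm_add {x : Torus Γ} (z γ : Cn n) (hγ : γ ∈ Γ) (hz : proj Γ z = x)
    (hz' : proj Γ (z + γ) = x) (e : Fiber Γ α x) :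
    (frame α (z + γ) hz').symm e = α γ * (frame α z hz).symm e := by
  rw [ContinuousLinearEquiv.symm_apply_eq, frame_apply, frameFun_add α z γ hγ hz hz',
    ← frame_apply, ContinuousLinearEquiv.apply_symm_apply]

variable (Γ) in
/-- `L_α` is trivial as a holomorphic line bundle: there is an isomorphism from `L_α` onto the
product bundle `(ℂⁿ/Γ) × ℂ`, that is, a family of linear isomorphisms from the fibres onto `ℂ`
which is holomorphic on the total space. A function on the total space `L_α = (ℂⁿ × ℂ)/Γ` is
holomorphic when its composition with the covering map `(z, v) ↦ [z, v]` is. (The inverse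
of such a bijective bundle map is holomorphic as well.) -/
def IsHolomorphicallyTrivial : Prop :=
  ∃ Φ : ∀ x : Torus Γ, Fiber Γ α x ≃ₗ[ℂ] ℂ,
    Differentiable ℂ fun a : Cn n × ℂ => Φ (proj Γ a.1) (frame α a.1 rfl a.2)

end Bundle

section LocalForms

/-- The space `Λᵏ` of complex valued `ℝ`-multilinear alternating forms of degree `k` on `ℂⁿ`. -/
abbrev Alt (n k : ℕ) : Type := Cn n [⋀^Fin k]→L[ℝ] ℂ

/-- A form of degree `p + q` is of type `(p, q)`, i.e. it is a linear combination of the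
`dz_I ∧ dz̄_J` with `|I| = p`, `|J| = q`: a scalar `c` acts on such a form, through
multiplication by `c` on all vectors, by `c ^ p * c̄ ^ q`. (The full space of forms of degree
`p + q` is the direct sum of the spaces of forms of type `(a, b)` with `a + b = p + q`, and these
characters are different, so this property singles out exactly the forms of type `(p, q)`.) -/
def IsType {n : ℕ} (p q : ℕ) {k : ℕ} (η : Alt n k) : Prop :=
  ∀ (c : ℂ) (v : Fin k → Cn n), η (fun i => c • v i) = c ^ p * (starRingEnd ℂ c) ^ q * η v

/-- Multiplication by `i` on `ℂⁿ`, as a real linear map. -/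
def mulI (n : ℕ) : Cn n →L[ℝ] Cn n :=
  (Complex.I • ContinuousLinearMap.id ℂ (Cn n)).restrictScalars ℝ

/-- The conjugate linear part `v ↦ (A v + i A (i v)) / 2` of a real linear map `A`.
For the differential `A = df` this is `∂̄f = ∑ⱼ (∂f/∂z̄ⱼ) dz̄ⱼ`. -/
def antilinearPart {n : ℕ} (F : Type) [NormedAddCommGroup F] [NormedSpace ℂ F] :
    (Cn n →L[ℝ] F) →L[ℝ] (Cn n →L[ℝ] F) :=
  (1 / 2 : ℂ) • (ContinuousLinearMap.id ℝ (Cn n →L[ℝ] F) +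
    Complex.I • (ContinuousLinearMap.compL ℝ (Cn n) (Cn n) F).flip (mulI n))

theorem antilinearPart_apply {n : ℕ} {F : Type} [NormedAddCommGroup F] [NormedSpace ℂ F]
    (A : Cn n →L[ℝ] F) (v : Cn n) :
    antilinearPart F A v = (1 / 2 : ℂ) • (A v + Complex.I • A (Complex.I • v)) := rfl

/-- The operator `∂̄ = ∑ⱼ dz̄ⱼ ∧ ∂/∂z̄ⱼ` on complex valued differential forms of degree `k`
on `ℂⁿ`. It differs from the exterior derivative of Mathlib only in that the differential of the
coefficients is replaced by its conjugate linear part. -/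
def dbarCn {n k : ℕ} (η : Cn n → Alt n k) (z : Cn n) : Alt n (k + 1) :=
  ContinuousAlternatingMap.alternatizeUncurryFin (antilinearPart _ (fderiv ℝ η z))

theorem dbarCn_eq {n k : ℕ} (η : Cn n → Alt n k) :
    dbarCn η = fun z => ((ContinuousAlternatingMap.alternatizeUncurryFinCLM ℝ (Cn n) ℂ).comp
      (antilinearPart (Alt n k))) (fderiv ℝ η z) := rfl

theorem dbarAux_smul {n k : ℕ} (c : ℂ) (L : Cn n →L[ℝ] Alt n k) :
    ((ContinuousAlternatingMap.alternatizeUncurryFinCLM ℝ (Cn n) ℂ).comp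
      (antilinearPart (Alt n k))) (c • L) =
    c • ((ContinuousAlternatingMap.alternatizeUncurryFinCLM ℝ (Cn n) ℂ).comp
      (antilinearPart (Alt n k))) L := by
  have h : antilinearPart (Alt n k) (c • L) = c • antilinearPart (Alt n k) L := by
    ext1 v
    simp only [antilinearPart_apply, smul_apply]
    module
  rw [ContinuousLinearMap.comp_apply, h]
  exact ContinuousAlternatingMap.alternatizeUncurryFin_smul c _

theorem dbarCn_add {n k : ℕ} {η θ : Cn n → Alt n k} (hη : ContDiff ℝ ∞ η)
    (hθ : ContDiff ℝ ∞ θ) : dbarCn (η + θ) = dbarCn η + dbarCn θ := by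
  funext z
  have h : fderiv ℝ (η + θ) z = fderiv ℝ η z + fderiv ℝ θ z :=
    fderiv_add (hη.differentiable (by simp) z) (hθ.differentiable (by simp) z)
  simp only [dbarCn_eq, Pi.add_apply, h, map_add]

theorem dbarCn_smul {n k : ℕ} {η : Cn n → Alt n k} (hη : ContDiff ℝ ∞ η) (c : ℂ) :
    dbarCn (c • η) = c • dbarCn η := by
  funext z
  have h : fderiv ℝ (c • η) z = c • fderiv ℝ η z :=
    fderiv_const_smul (hη.differentiable (by simp) z) c
  simp only [dbarCn_eq, Pi.smul_apply, h]
  exact dbarAux_smul c _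

theorem contDiff_dbarCn {n k : ℕ} {η : Cn n → Alt n k} (hη : ContDiff ℝ ∞ η) :
    ContDiff ℝ ∞ (dbarCn η) := by
  rw [dbarCn_eq]
  exact (ContinuousLinearMap.contDiff _).comp (hη.fderiv_right (by simp))

theorem antilinearPart_smul {n : ℕ} {F : Type} [NormedAddCommGroup F] [NormedSpace ℂ F]
    (A : Cn n →L[ℝ] F) (c : ℂ) (v : Cn n) :
    antilinearPart F A (c • v) = (starRingEnd ℂ c) • antilinearPart F A v := by
  have h : c • v = c.re • v + c.im • (Complex.I • v) := by
    conv_lhs => rw [← Complex.re_add_im c]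
    rw [add_smul, mul_smul]; rfl
  have h' : Complex.I • c • v = c.re • (Complex.I • v) - c.im • v := by
    rw [h, smul_add, smul_comm Complex.I c.re, smul_comm Complex.I c.im, smul_smul,
      Complex.I_mul_I, neg_one_smul, smul_neg, sub_eq_add_neg]
  have hc : starRingEnd ℂ c = (c.re : ℂ) - c.im * Complex.I := by
    apply Complex.ext <;> simp
  have e1 : A (c • v) = (c.re : ℂ) • A v + (c.im : ℂ) • A (Complex.I • v) := by
    rw [h, map_add, A.map_smul, A.map_smul, Complex.coe_smul, Complex.coe_smul]
  have e2 : A (Complex.I • c • v) = (c.re : ℂ) • A (Complex.I • v) - (c.im : ℂ) • A v := by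
    rw [h', map_sub, A.map_smul, A.map_smul, Complex.coe_smul, Complex.coe_smul]
  rw [antilinearPart_apply, antilinearPart_apply, e1, e2, hc]
  match_scalars
  · ring
  · linear_combination (c.im : ℂ) * (1 / 2) * Complex.I_mul_I

theorem isType_fderiv {n p q k : ℕ} {η : Cn n → Alt n k} (hη : ContDiff ℝ ∞ η)
    (h : ∀ z, IsType p q (η z)) (z u : Cn n) : IsType p q (fderiv ℝ η z u) := by
  intro c v
  have hd : HasFDerivAt η (fderiv ℝ η z) z :=
    (hη.differentiable (by simp) z).hasFDerivAt
  have h1 : ∀ w : Fin k → Cn n, HasFDerivAt (fun y => η y w)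
      ((ContinuousAlternatingMap.apply ℝ (Cn n) ℂ w).comp (fderiv ℝ η z)) z := fun w =>
    (ContinuousAlternatingMap.apply ℝ (Cn n) ℂ w).hasFDerivAt.comp z hd
  have h2 := (h1 v).const_mul (c ^ p * (starRingEnd ℂ c) ^ q)
  have h3 := h1 fun i => c • v i
  simp only [h _ c v] at h3
  exact congrArg (fun A : Cn n →L[ℝ] ℂ => A u) (h3.unique h2)

theorem isType_dbarCn {n p q k : ℕ} {η : Cn n → Alt n k} (hη : ContDiff ℝ ∞ η)
    (h : ∀ z, IsType p q (η z)) (z : Cn n) : IsType p (q + 1) (dbarCn η z) := by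
  intro c v
  have h1 : ∀ u, IsType p q (antilinearPart (Alt n k) (fderiv ℝ η z) u) := by
    intro u c v
    have e1 := isType_fderiv hη h z u c v
    have e2 := isType_fderiv hη h z (Complex.I • u) c v
    rw [antilinearPart_apply]
    simp only [ContinuousAlternatingMap.smul_apply, ContinuousAlternatingMap.add_apply, e1, e2,
      smul_eq_mul]
    ring
  unfold dbarCn
  rw [ContinuousAlternatingMap.alternatizeUncurryFin_apply,
    ContinuousAlternatingMap.alternatizeUncurryFin_apply, Finset.mul_sum]
  refine Finset.sum_congr rfl fun i _ => ?_
  have h2 : i.removeNth (fun j => c • v j) = fun j => c • i.removeNth v j := rfl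
  rw [antilinearPart_smul, h2, ContinuousAlternatingMap.smul_apply, h1 (v i) c]
  simp only [smul_eq_mul, zsmul_eq_mul, Int.cast_pow, Int.cast_neg, Int.cast_one]
  ring

theorem dbarCn_dbarCn {n k : ℕ} {η : Cn n → Alt n k} (hη : ContDiff ℝ ∞ η) :
    dbarCn (dbarCn η) = 0 := by
  funext z
  have hd : HasFDerivAt (fderiv ℝ η) (fderiv ℝ (fderiv ℝ η) z) z :=
    ((hη.fderiv_right (m := ∞) (by simp)).differentiable (by simp) z).hasFDerivAt
  have hsymm : IsSymmSndFDerivAt ℝ η z := hη.contDiffAt.isSymmSndFDerivAt (by simp; exact WithTop.coe_le_coe.2 le_top)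
  have h1 : HasFDerivAt (dbarCn η) (((ContinuousAlternatingMap.alternatizeUncurryFinCLM ℝ
      (Cn n) ℂ).comp (antilinearPart (Alt n k))).comp (fderiv ℝ (fderiv ℝ η) z)) z := by
    rw [dbarCn_eq]
    exact (ContinuousLinearMap.hasFDerivAt _).comp z hd
  have h2 : antilinearPart _ (((ContinuousAlternatingMap.alternatizeUncurryFinCLM ℝ
      (Cn n) ℂ).comp (antilinearPart (Alt n k))).comp (fderiv ℝ (fderiv ℝ η) z)) =
      (ContinuousAlternatingMap.alternatizeUncurryFinCLM ℝ (Cn n) ℂ).comp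
        (antilinearPart _ ((antilinearPart (Alt n k)).comp (fderiv ℝ (fderiv ℝ η) z))) := by
    have hs : ∀ (c : ℂ) (L : Cn n →L[ℝ] Alt n k),
        ContinuousAlternatingMap.alternatizeUncurryFinCLM ℝ (Cn n) ℂ (c • L) =
          c • ContinuousAlternatingMap.alternatizeUncurryFinCLM ℝ (Cn n) ℂ L := fun c L =>
      ContinuousAlternatingMap.alternatizeUncurryFin_smul c L
    ext1 v
    rw [ContinuousLinearMap.comp_apply, antilinearPart_apply, antilinearPart_apply, hs, map_add,
      hs]
    rfl
  show ContinuousAlternatingMap.alternatizeUncurryFin (antilinearPart _ (fderiv ℝ (dbarCn η) z)) = 0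
  rw [h1.fderiv, h2]
  refine
    ContinuousAlternatingMap.alternatizeUncurryFin_alternatizeUncurryFinCLM_comp_of_symmetric ?_
  intro u v
  simp only [antilinearPart_apply, ContinuousLinearMap.comp_apply, add_apply, smul_apply]
  rw [hsymm.eq u v, hsymm.eq (Complex.I • u) v, hsymm.eq u (Complex.I • v),
    hsymm.eq (Complex.I • u) (Complex.I • v)]
  module

end LocalForms

section Dolbeault

variable {n : ℕ} {Γ : Submodule ℤ (Cn n)} (α : AddChar (Cn n) ℂ)

variable (Γ) in
/-- Differential forms of degree `k` on the torus with values in `L_α` (no regularity yet): at each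
point `x`, an alternating map from tangent vectors to the fibre of `L_α` over `x`. -/
def BundleForm (k : ℕ) : Type := ∀ x : Torus Γ, Cn n [⋀^Fin k]→L[ℝ] Fiber Γ α x

instance (k : ℕ) : AddCommGroup (BundleForm Γ α k) :=
  inferInstanceAs (AddCommGroup (∀ x : Torus Γ, Cn n [⋀^Fin k]→L[ℝ] Fiber Γ α x))

instance (k : ℕ) : Module ℂ (BundleForm Γ α k) :=
  inferInstanceAs (Module ℂ (∀ x : Torus Γ, Cn n [⋀^Fin k]→L[ℝ] Fiber Γ α x))

/-- The expression of an `L_α`-valued form in the frame `v ↦ [z, v]` of `L_α`; this is its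
pull-back to a complex valued form on `ℂⁿ`. -/
def lift {k : ℕ} : BundleForm Γ α k →ₗ[ℂ] (Cn n → Alt n k) where
  toFun η z := ((frame α z rfl).symm.toContinuousLinearMap.restrictScalars
    ℝ).compContinuousAlternatingMap (η (proj Γ z))
  map_add' η θ := by ext z v; exact map_add (frame α z rfl).symm _ _
  map_smul' c η := by ext z v; exact map_smul (frame α z rfl).symm _ _

theorem lift_apply {k : ℕ} (η : BundleForm Γ α k) (z : Cn n) (v : Fin k → Cn n) :
    lift α η z v = (frame α z rfl).symm (η (proj Γ z) v) := rfl

/-- The pull-back of an `L_α`-valued form is `Γ`-equivariant. -/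
theorem lift_add {k : ℕ} (η : BundleForm Γ α k) (z γ : Cn n) (hγ : γ ∈ Γ) :
    lift α η (z + γ) = α γ • lift α η z := by
  have h : proj Γ (z + γ) = proj Γ z := (Submodule.Quotient.eq Γ).2 (by simpa using hγ)
  have key : ∀ (x : Torus Γ) (hx : proj Γ (z + γ) = x) (v : Fin k → Cn n),
      (frame α (z + γ) rfl).symm (η (proj Γ (z + γ)) v) =
        (frame α (z + γ) hx).symm (η x v) := by
    rintro x rfl v; rfl
  ext v
  rw [lift_apply, key _ h v, frame_symm_add α z γ hγ rfl h]
  rfl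

theorem lift_injective {k : ℕ} :
    Function.Injective (lift α : BundleForm Γ α k →ₗ[ℂ] (Cn n → Alt n k)) := by
  intro η θ h
  funext x
  obtain ⟨z, rfl⟩ : ∃ z, proj Γ z = x := ⟨rep x, proj_rep x⟩
  ext v
  have := congrArg (fun f => f z v) h
  simpa only [lift_apply, EmbeddingLike.apply_eq_iff_eq] using this

/-- The operator `∂̄` on `L_α`-valued forms: in the frames `v ↦ [z, v]` (which are constant, hence
holomorphic, in the local trivializations), it is the operator `∂̄` on the coefficients. -/
def dbar {k : ℕ} (η : BundleForm Γ α k) : BundleForm Γ α (k + 1) := fun x =>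
  ((frame α (rep x) (proj_rep x)).toContinuousLinearMap.restrictScalars
    ℝ).compContinuousAlternatingMap (dbarCn (lift α η) (rep x))

theorem dbarCn_lift_add {k : ℕ} (η : BundleForm Γ α k) (z γ : Cn n) (hγ : γ ∈ Γ) :
    dbarCn (lift α η) (z + γ) = α γ • dbarCn (lift α η) z := by
  have h1 : (fun y => lift α η (y + γ)) = α γ • lift α η :=
    funext fun y => lift_add α η y γ hγ
  have h2 : fderiv ℝ (lift α η) (z + γ) = α γ • fderiv ℝ (lift α η) z := by
    have hu : Invertible (α γ) := (α.val_isUnit γ).invertible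
    rw [← fderiv_comp_add_right, h1]
    exact fderiv_const_smul_of_invertible (f := lift α η) (α γ)
  rw [dbarCn_eq]
  simp only [h2]
  exact dbarAux_smul (α γ) _

/-- The pull-back commutes with `∂̄`; in particular, `dbar` does not depend on the choice of the
points above points of the torus. -/
theorem lift_dbar {k : ℕ} (η : BundleForm Γ α k) : lift α (dbar α η) = dbarCn (lift α η) := by
  funext z
  obtain ⟨γ, hγ, h⟩ := exists_mem_of_proj_eq (proj_rep (proj Γ z)).symm
  have key : ∀ (w : Cn n) (hw : proj Γ w = proj Γ z) (v : Fin (k + 1) → Cn n), w = z + γ →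
      frame α w hw (dbarCn (lift α η) w v) = frame α z rfl (dbarCn (lift α η) z v) := by
    rintro w hw v rfl
    rw [dbarCn_lift_add α η z γ hγ, ContinuousAlternatingMap.smul_apply, smul_eq_mul,
      frame_apply, frame_apply, frameFun_add α z γ hγ rfl hw]
  ext v
  rw [lift_apply, ContinuousLinearEquiv.symm_apply_eq]
  exact key _ (proj_rep (proj Γ z)) v h

variable (Γ) in
/-- The space `A^{p,q}(ℂⁿ/Γ, L_α)` of smooth `L_α`-valued forms of type `(p, q)`. -/
def DolbeaultForms (p q : ℕ) : Submodule ℂ (BundleForm Γ α (p + q)) where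
  carrier := {η | ContDiff ℝ ∞ (lift α η) ∧ ∀ z, IsType p q (lift α η z)}
  zero_mem' := by
    refine ⟨?_, fun z c v => ?_⟩
    · rw [map_zero]; exact contDiff_const
    · simp
  add_mem' := by
    rintro η θ ⟨h1, h2⟩ ⟨h3, h4⟩
    refine ⟨?_, fun z c v => ?_⟩
    · rw [map_add]; exact h1.add h3
    · have e1 := h2 z c v
      have e2 := h4 z c v
      rw [map_add, Pi.add_apply, ContinuousAlternatingMap.add_apply,
        ContinuousAlternatingMap.add_apply, e1, e2, mul_add]
  smul_mem' := by
    rintro a η ⟨h1, h2⟩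
    refine ⟨?_, fun z c v => ?_⟩
    · rw [map_smul]; exact h1.const_smul a
    · have e1 := h2 z c v
      rw [map_smul, Pi.smul_apply, ContinuousAlternatingMap.smul_apply,
        ContinuousAlternatingMap.smul_apply, e1, smul_eq_mul, smul_eq_mul]
      ring

variable (Γ) in
/-- The Dolbeault operator `∂̄ : A^{p,q}(ℂⁿ/Γ, L_α) → A^{p,q+1}(ℂⁿ/Γ, L_α)`. -/
def dolbeault (p q : ℕ) : DolbeaultForms Γ α p q →ₗ[ℂ] DolbeaultForms Γ α p (q + 1) where
  toFun η := ⟨dbar α η.1, by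
    refine ⟨?_, fun z => ?_⟩
    · exact (lift_dbar α η.1) ▸ contDiff_dbarCn η.2.1
    · exact (lift_dbar α η.1) ▸ isType_dbarCn η.2.1 η.2.2 z⟩
  map_add' η θ := by
    refine Subtype.ext (lift_injective α ?_)
    show lift α (dbar α (η.1 + θ.1)) = lift α (dbar α η.1 + dbar α θ.1)
    rw [lift_dbar, map_add, map_add, lift_dbar, lift_dbar, dbarCn_add η.2.1 θ.2.1]
  map_smul' c η := by
    refine Subtype.ext (lift_injective α ?_)
    show lift α (dbar α (c • η.1)) = lift α (c • dbar α η.1)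
    rw [lift_dbar, map_smul, map_smul, lift_dbar, dbarCn_smul η.2.1]

theorem dolbeault_dolbeault (p q : ℕ) (η : DolbeaultForms Γ α p q) :
    dolbeault Γ α p (q + 1) (dolbeault Γ α p q η) = 0 := by
  refine Subtype.ext (lift_injective α ?_)
  show lift α (dbar α (dbar α η.1)) = lift α 0
  rw [lift_dbar, lift_dbar, dbarCn_dbarCn η.2.1, map_zero]

variable (Γ) in
/-- The exact forms in `A^{p,q}(ℂⁿ/Γ, L_α)`: the image of `∂̄` on `A^{p,q-1}`, and zero
for `q = 0`. -/
def exactForms (p : ℕ) : ∀ q : ℕ, Submodule ℂ (DolbeaultForms Γ α p q)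
  | 0 => ⊥
  | q + 1 => LinearMap.range (dolbeault Γ α p q)

variable (Γ) in
/-- The Dolbeault cohomology `H^{p,q}(ℂⁿ/Γ, L_α)`: the closed forms of type `(p, q)` modulo the
exact ones. -/
abbrev DolbeaultCohomology (p q : ℕ) : Type :=
  LinearMap.ker (dolbeault Γ α p q) ⧸
    (exactForms Γ α p q).submoduleOf (LinearMap.ker (dolbeault Γ α p q))

end Dolbeault

end ComplexTorus

end

/-!
The character `α` is the exponential of a real linear form `l` (`exists_eq_exp`), so division by
`exp l` identifies the forms with values in `L_α` with the `Γ`-periodic forms on `ℂⁿ`, and `∂̄`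
becomes `∂̄ + l^{0,1} ∧` (`dbarCn_exp_smul`), where `A^{0,1}` is the conjugate linear part of `A`.
Coordinates adapted to a basis of `Γ` turn periodic forms into functions on `ℝ^ι` with period
lattice `ℤ^ι`, which are Fourier series with rapidly decreasing coefficients (`fourierSum_coef`,
`rapidDecay_coef`); conversely such coefficients define smooth functions (`contDiff_fourierSum`).
On the `m`-th coefficient the operator acts as the exterior product with the constant form
`A_m^{0,1}`, where `A_m = l + 2πi m` is `expForm l B m`.

If `A_m^{0,1} = 0` for some `m`, then `exp A_m` is a nowhere vanishing holomorphic section of `L_α`,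
which is therefore trivial (`isHolomorphicallyTrivial_of_antilinearPart_eq_zero`). Hence, for
non-trivial `L_α`, all `A_m^{0,1}` are different from zero, and since they tend to infinity with
`m`, their norms are bounded below (`exists_le_norm_antilinearPart`): there are bounded vectors
`w_m` with `A_m^{0,1}(w_m) = 1`.

The coefficients `a_m` of a closed form satisfy `A_m^{0,1} ∧ a_m = 0`. Contraction with the
`(0, 1)`-part of `w_m` gives `b_m` with `A_m^{0,1} ∧ b_m = a_m` (`wedge_contract_eq`), and `b_m` is
again rapidly decreasing, so that the form with the coefficients `b_m` is a primitive. In type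
`(p, 0)` the contraction is zero (`contract_eq_zero`), and so is the closed form.
-/

noncomputable section

namespace ComplexTorus

/-! ### Fourier coefficients of periodic functions -/

section Fourier

open MeasureTheory Set Filter

variable {ι : Type} [Fintype ι] {E : Type} [NormedAddCommGroup E] [NormedSpace ℝ E]

/-- The linear form `x ↦ 2πi ∑ⱼ mⱼ xⱼ`; the characters of `ℝ^ι / ℤ^ι` are `exp ∘ freq m`. -/
def freq (m : ι → ℤ) : (ι → ℝ) →L[ℝ] ℂ :=
  ∑ i, (2 * Real.pi * Complex.I * m i) • Complex.ofRealCLM.comp (ContinuousLinearMap.proj i)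

theorem freq_apply (m : ι → ℤ) (x : ι → ℝ) :
    freq m x = ∑ i, 2 * Real.pi * Complex.I * m i * x i := by
  simp [freq]

theorem freq_neg (m : ι → ℤ) (x : ι → ℝ) : freq (-m) x = -freq m x := by
  simp [freq_apply]

theorem freq_re (m : ι → ℤ) (x : ι → ℝ) : (freq m x).re = 0 := by
  rw [freq_apply, Complex.re_sum]
  refine Finset.sum_eq_zero fun i _ => ?_
  have : 2 * (Real.pi : ℂ) * Complex.I * m i * x i =
      ((2 * Real.pi * m i * x i : ℝ) : ℂ) * Complex.I := by push_cast; ring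
  rw [this, Complex.re_ofReal_mul, Complex.I_re, mul_zero]

theorem norm_exp_freq (m : ι → ℤ) (x : ι → ℝ) : ‖Complex.exp (freq m x)‖ = 1 := by
  rw [Complex.norm_exp, freq_re, Real.exp_zero]

theorem exp_freq_intCast (m k : ι → ℤ) : Complex.exp (freq m fun i => (k i : ℝ)) = 1 := by
  rw [freq_apply, Complex.exp_eq_one_iff]
  refine ⟨∑ i, m i * k i, ?_⟩
  push_cast
  rw [Finset.sum_mul]
  exact Finset.sum_congr rfl fun i _ => by ring

theorem exp_freq_add_intCast (m k : ι → ℤ) (x : ι → ℝ) :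
    Complex.exp (freq m (x + fun i => (k i : ℝ))) = Complex.exp (freq m x) := by
  rw [map_add, Complex.exp_add, exp_freq_intCast, mul_one]

theorem exp_freq_eq_mFourier (m : ι → ℤ) (x : ι → ℝ) :
    Complex.exp (freq m x) = UnitAddTorus.mFourier m fun i => (x i : UnitAddCircle) := by
  rw [freq_apply, Complex.exp_sum]
  refine Finset.prod_congr rfl fun i _ => ?_
  rw [fourier_coe_apply]
  simp

theorem norm_freq_le (m : ι → ℤ) : ‖freq m‖ ≤ Fintype.card ι * (2 * Real.pi) * ‖m‖ := by
  refine ContinuousLinearMap.opNorm_le_bound _ (by positivity) fun x => ?_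
  rw [freq_apply]
  refine (norm_sum_le _ _).trans ((Finset.sum_le_card_nsmul _ _ (2 * Real.pi * ‖m‖ * ‖x‖)
    fun i _ => ?_).trans_eq ?_)
  · have h1 : ‖m i‖ ≤ ‖m‖ := norm_le_pi_norm m i
    have h2 : ‖x i‖ ≤ ‖x‖ := norm_le_pi_norm x i
    rw [norm_mul, norm_mul, norm_mul, norm_mul, Complex.norm_I, Complex.norm_real,
      Complex.norm_real, Complex.norm_intCast, Real.norm_of_nonneg Real.pi_pos.le]
    rw [Int.norm_eq_abs] at h1
    simp only [Complex.norm_ofNat, mul_one]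
    gcongr
  · rw [Finset.card_univ, nsmul_eq_mul]; ring

/-- Invariance of a function on `ℝ^ι` under translation by `ℤ^ι`. -/
def IsIntPeriodic {κ X : Type} (h : (κ → ℝ) → X) : Prop :=
  ∀ x (k : κ → ℤ), h (x + fun i => (k i : ℝ)) = h x

/-- A periodic function factors through the torus `(ℝ/ℤ)^ι`. -/
theorem IsIntPeriodic.exists_torus {κ X : Type} {h : (κ → ℝ) → X} (hp : IsIntPeriodic h) :
    ∃ H : UnitAddTorus κ → X, ∀ x : κ → ℝ, H (fun i => (x i : UnitAddCircle)) = h x := by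
  refine ⟨fun y => h fun i => (y i).out, fun x => ?_⟩
  have : ∀ i, ∃ k : ℤ, (x i : UnitAddCircle).out = x i + k := fun i => by
    have h1 : ((x i : UnitAddCircle).out : UnitAddCircle) = x i := Quotient.out_eq' _
    rw [← sub_eq_zero, ← AddCircle.coe_sub, AddCircle.coe_eq_zero_iff] at h1
    obtain ⟨k, hk⟩ := h1
    exact ⟨k, by rw [zsmul_eq_mul, mul_one] at hk; linarith⟩
  choose k hk using this
  rw [← hp x k]
  exact congrArg h (funext hk)

theorem IsIntPeriodic.bounded {κ X : Type} [NormedAddCommGroup X] {h : (κ → ℝ) → X}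
    (hp : IsIntPeriodic h) (hc : Continuous h) :
    ∃ C, ∀ x, ‖h x‖ ≤ C := by
  obtain ⟨C, hC⟩ := (isCompact_Icc (a := (0 : κ → ℝ)) (b := 1)).exists_bound_of_continuousOn
    hc.continuousOn
  refine ⟨C, fun x => ?_⟩
  rw [← hp x fun i => -⌊x i⌋]
  refine hC _ ⟨fun i => ?_, fun i => ?_⟩
  · have := Int.floor_le (x i)
    simpa using this
  · have := (Int.lt_floor_add_one (x i)).le
    simp only [Pi.add_apply, Int.cast_neg, Pi.one_apply]
    linarith

theorem IsIntPeriodic.fderiv {h : (ι → ℝ) → E} (hp : IsIntPeriodic h) :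
    IsIntPeriodic (fderiv ℝ h) := by
  intro x k
  rw [← fderiv_comp_add_right]
  exact congrArg (fun f => _root_.fderiv ℝ f x) (funext fun y => hp y k)

variable (ι) in
/-- The half open unit cube with lower corner `a`. -/
def unitBox (a : ι → ℝ) : Set (ι → ℝ) := {x | ∀ i, x i ∈ Ioc (a i) (a i + 1)}

theorem volume_unitBox (a : ι → ℝ) : volume (unitBox ι a) = 1 := by
  have : unitBox ι a = Set.pi univ fun i => Ioc (a i) (a i + 1) := by ext; simp [unitBox]
  rw [this, Real.volume_pi_Ioc]
  simp

theorem integrableOn_unitBox {X : Type} [NormedAddCommGroup X] {h : (ι → ℝ) → X} (hc : Continuous h)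
    (a : ι → ℝ) :
    IntegrableOn h (unitBox ι a) :=
  (hc.integrableOn_Icc (a := a) (b := a + 1)).mono_set
    fun _ hx => ⟨fun i => (hx i).1.le, fun i => (hx i).2⟩

/-- The integral of a periodic function over the unit cube is invariant under translation. -/
theorem IsIntPeriodic.integral_comp_add {h : (ι → ℝ) → E} (hp : IsIntPeriodic h) (a : ι → ℝ) :
    ∫ x in unitBox ι 0, h (x + a) = ∫ x in unitBox ι 0, h x := by
  have h1 := (measurePreserving_add_right (volume : Measure (ι → ℝ)) a).setIntegral_preimage_emb
    (MeasurableEquiv.addRight a).measurableEmbedding h (unitBox ι a)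
  have h2 : (fun x : ι → ℝ => x + a) ⁻¹' unitBox ι a = unitBox ι 0 := by
    ext x
    refine forall_congr' fun i => ?_
    simp only [Pi.add_apply, Pi.zero_apply, mem_Ioc]
    constructor <;> rintro ⟨h3, h4⟩ <;> constructor <;> linarith
  obtain ⟨H, hH⟩ := hp.exists_torus
  rw [h2] at h1
  rw [h1]
  have h3 := (UnitAddTorus.integral_preimage H a).symm.trans (UnitAddTorus.integral_preimage H 0)
  simp only [hH] at h3
  exact h3

/-- The integral of a derivative over a period vanishes: it is the derivative of the integral of the
translates, which is constant. -/
theorem IsIntPeriodic.integral_fderiv {h : (ι → ℝ) → E} (hp : IsIntPeriodic h)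
    (hd : ContDiff ℝ 1 h) (v : ι → ℝ) : ∫ x in unitBox ι 0, _root_.fderiv ℝ h x v = 0 := by
  have hc' : Continuous fun x => _root_.fderiv ℝ h x v :=
    (hd.continuous_fderiv one_ne_zero).clm_apply continuous_const
  have hp' : IsIntPeriodic fun x => _root_.fderiv ℝ h x v := fun x k =>
    congrArg (fun A : (ι → ℝ) →L[ℝ] E => A v) (hp.fderiv x k)
  obtain ⟨C, hC⟩ := hp'.bounded hc'
  have h1 : HasDerivAt (fun t : ℝ => ∫ x in unitBox ι 0, h (x + t • v))
      (∫ x in unitBox ι 0, _root_.fderiv ℝ h (x + (0 : ℝ) • v) v) 0 := by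
    refine (hasDerivAt_integral_of_dominated_loc_of_deriv_le (s := univ) (bound := fun _ => C)
      (F' := fun t x => _root_.fderiv ℝ h (x + t • v) v) univ_mem ?_ ?_ ?_ ?_ ?_ ?_).2
    · exact Eventually.of_forall fun t =>
        (hd.continuous.comp (by fun_prop : Continuous fun x : ι → ℝ => x + t • v)).aestronglyMeasurable
    · exact integrableOn_unitBox
        (hd.continuous.comp (by fun_prop : Continuous fun x : ι → ℝ => x + (0 : ℝ) • v)) 0
    · exact (hc'.comp
        (by fun_prop : Continuous fun x : ι → ℝ => x + (0 : ℝ) • v)).aestronglyMeasurable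
    · exact Eventually.of_forall fun x t _ => hC _
    · exact integrableOn_unitBox continuous_const 0
    · refine Eventually.of_forall fun x t _ => ?_
      have h2 : HasDerivAt (fun t : ℝ => x + t • v) v t := by
        simpa using ((hasDerivAt_id t).smul_const v).const_add x
      exact ((hd.differentiable one_ne_zero _).hasFDerivAt).comp_hasDerivAt t h2
  simp only [hp.integral_comp_add, zero_smul, add_zero] at h1
  exact h1.unique (hasDerivAt_const _ _)

variable [NormedSpace ℂ E]

/-- The Fourier coefficient of index `m` of a periodic function, as an integral over the unit cube
for Lebesgue measure. -/
def coef (h : (ι → ℝ) → E) (m : ι → ℤ) : E :=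
  ∫ x in unitBox ι 0, Complex.exp (freq (-m) x) • h x

theorem continuous_exp_freq (m : ι → ℤ) : Continuous fun x => Complex.exp (freq m x) := by
  fun_prop

theorem hasFDerivAt_exp_freq (m : ι → ℤ) (x : ι → ℝ) :
    HasFDerivAt (fun x => Complex.exp (freq m x)) (Complex.exp (freq m x) • freq m) x :=
  (freq m).hasFDerivAt.cexp

theorem norm_coef_le {h : (ι → ℝ) → E} {C : ℝ} (hC : ∀ x, ‖h x‖ ≤ C) (m : ι → ℤ) :
    ‖coef h m‖ ≤ C := by
  refine (norm_setIntegral_le_of_norm_le_const (C := C) ?_ fun x _ => ?_).trans_eq ?_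
  · rw [volume_unitBox]; exact ENNReal.one_lt_top
  · rw [norm_smul, norm_exp_freq, one_mul]; exact hC x
  · rw [measureReal_def, volume_unitBox, ENNReal.toReal_one, mul_one]

theorem coef_comp {F : Type} [NormedAddCommGroup F] [NormedSpace ℝ F] [NormedSpace ℂ F]
    [CompleteSpace E] [CompleteSpace F] {h : (ι → ℝ) → E} (hc : Continuous h)
    (W : E →L[ℝ] F) (hW : ∀ (c : ℂ) x, W (c • x) = c • W x) (m : ι → ℤ) :
    coef (fun x => W (h x)) m = W (coef h m) := by
  rw [coef, coef, ← W.integral_comp_comm]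
  · simp only [hW]
  · exact integrableOn_unitBox ((continuous_exp_freq _).smul hc) 0

theorem coef_neg (h : (ι → ℝ) → E) (m : ι → ℤ) : coef (fun x => -h x) m = -coef h m := by
  simp only [coef, smul_neg, integral_neg]

variable [IsScalarTower ℝ ℂ E]

/-- Differentiation multiplies the Fourier coefficients by `freq m`. -/
theorem coef_fderiv [CompleteSpace E] {h : (ι → ℝ) → E} (hp : IsIntPeriodic h)
    (hd : ContDiff ℝ 1 h) (m : ι → ℤ) :
    coef (fderiv ℝ h) m = (freq m).smulRight (coef h m) := by
  ext v
  have hK : IsIntPeriodic fun x => Complex.exp (freq (-m) x) • h x := fun x k => by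
    simp only [hp x k, exp_freq_add_intCast]
  have hdh : Differentiable ℝ h := hd.differentiable one_ne_zero
  have hK1 : ContDiff ℝ 1 fun x => Complex.exp (freq (-m) x) • h x :=
    (freq (-m)).contDiff.cexp.smul hd
  have hK2 : ∀ x, fderiv ℝ (fun x => Complex.exp (freq (-m) x) • h x) x v =
      Complex.exp (freq (-m) x) • fderiv ℝ h x v -
        freq m v • Complex.exp (freq (-m) x) • h x := fun x => by
    have h2 : fderiv ℝ (fun x => Complex.exp (freq (-m) x) • h x) x = _ :=
      ((hasFDerivAt_exp_freq (-m) x).smul (hdh x).hasFDerivAt).fderiv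
    rw [h2]
    simp only [add_apply, smul_apply, ContinuousLinearMap.smulRight_apply, freq_neg m v]
    module
  have hi1 : IntegrableOn (fun x => Complex.exp (freq (-m) x) • fderiv ℝ h x v) (unitBox ι 0) :=
    integrableOn_unitBox ((continuous_exp_freq _).smul
      ((hd.continuous_fderiv one_ne_zero).clm_apply continuous_const)) 0
  have hi2 : IntegrableOn (fun x => Complex.exp (freq (-m) x) • h x) (unitBox ι 0) :=
    integrableOn_unitBox hK1.continuous 0
  -- integration by parts
  have h1 := hK.integral_fderiv hK1 v
  simp only [hK2] at h1
  rw [integral_sub hi1 (hi2.fun_smul _), integral_smul, sub_eq_zero] at h1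
  rw [ContinuousLinearMap.smulRight_apply, coef, coef, ← h1, ContinuousLinearMap.integral_apply]
  · rfl
  · exact integrableOn_unitBox ((continuous_exp_freq _).smul
      (hd.continuous_fderiv one_ne_zero)) 0

/-- Decay faster than every power of `‖m‖`, for the supremum norm on `ℤ^ι`. -/
def RapidDecay {X : Type} [NormedAddCommGroup X] (a : (ι → ℤ) → X) : Prop :=
  ∀ N : ℕ, ∃ C, ∀ m, ‖m‖ ^ N * ‖a m‖ ≤ C

theorem norm_mul_le_norm_freq_smulRight (m : ι → ℤ) (a : E) :
    ‖m‖ * ‖a‖ ≤ ‖(freq m).smulRight a‖ := by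
  classical
  rcases (norm_nonneg a).eq_or_lt with ha | ha
  · rw [← ha, mul_zero]; exact norm_nonneg _
  rw [← le_div_iff₀ ha, pi_norm_le_iff_of_nonneg (by positivity)]
  intro i
  rw [le_div_iff₀ ha]
  have h1 := ((freq m).smulRight a).le_opNorm (Pi.single i 1)
  rw [Pi.norm_single, norm_one, mul_one, ContinuousLinearMap.smulRight_apply, norm_smul,
    freq_apply, Finset.sum_eq_single i] at h1
  · refine le_trans (mul_le_mul_of_nonneg_right ?_ ha.le) h1
    have hpi := Real.pi_gt_three
    rw [Pi.single_eq_same, norm_mul, norm_mul, norm_mul, norm_mul, Complex.norm_I,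
      Complex.norm_real, Complex.norm_intCast, Real.norm_of_nonneg Real.pi_pos.le]
    simp only [Complex.norm_ofNat, Int.norm_eq_abs, Complex.ofReal_one, norm_one, mul_one]
    nlinarith [abs_nonneg (m i : ℝ)]
  · intro j _ hj; simp [hj]
  · simp

/-- Each differentiation gains one power of `‖m‖`, by `coef_fderiv`. -/
theorem rapidDecay_coef [CompleteSpace E] {h : (ι → ℝ) → E} (hp : IsIntPeriodic h)
    (hd : ContDiff ℝ ∞ h) : RapidDecay (coef h) := by
  intro N
  induction N generalizing E with
  | zero =>
    obtain ⟨C, hC⟩ := hp.bounded hd.continuous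
    exact ⟨C, fun m => by simpa using norm_coef_le hC m⟩
  | succ N ih =>
    obtain ⟨C, hC⟩ := ih hp.fderiv (hd.fderiv_right (by simp))
    refine ⟨C, fun m => le_trans ?_ (hC m)⟩
    rw [coef_fderiv hp (hd.of_le (by simp)), pow_succ, mul_assoc]
    gcongr
    exact norm_mul_le_norm_freq_smulRight m _

end Fourier

/-! ### Fourier series with rapidly decreasing coefficients -/

section Series

open MeasureTheory Set Filter

variable {ι : Type} [Fintype ι] {E : Type} [NormedAddCommGroup E]

/-- Over `ℤ^ι`, the series `∑ ‖m‖⁻ⁿ` converges for large `n` (the term of index `0` is `0`). -/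
theorem exists_summable_norm_inv_pow (ι : Type) [Fintype ι] :
    ∃ n : ℕ, Summable fun m : ι → ℤ => ‖m‖⁻¹ ^ n := by
  classical
  let L : Submodule ℤ (ι → ℝ) := Submodule.span ℤ (range (Pi.basisFun ℝ ι))
  have hL : ∀ m : ι → ℤ, (fun i => (m i : ℝ)) ∈ L := fun m => by
    have : (fun i => (m i : ℝ)) = ∑ i, m i • Pi.basisFun ℝ ι i := by
      ext j; simp [Finset.sum_apply, Pi.single_apply]
    rw [this]
    exact Submodule.sum_mem _ fun i _ => L.smul_mem _ (Submodule.subset_span ⟨i, rfl⟩)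
  refine ⟨Module.finrank ℤ L + 1, ?_⟩
  have h1 := ZLattice.summable_norm_pow_inv L _ (Nat.lt_succ_self _)
  have h2 := h1.comp_injective (i := fun m : ι → ℤ => (⟨_, hL m⟩ : L)) fun m k hmk => by
    ext i
    have h3 : (m i : ℝ) = k i := congrFun (congrArg Subtype.val hmk) i
    exact_mod_cast h3
  refine h2.congr fun m => ?_
  have : ‖fun i => (m i : ℝ)‖ = ‖m‖ := by
    simp only [Pi.norm_def, Int.norm_eq_abs, nnnorm]
    rfl
  simp only [Function.comp_apply, Submodule.coe_norm, this]

theorem RapidDecay.summable_pow_mul {a : (ι → ℤ) → E} (ha : RapidDecay a) (k : ℕ) :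
    Summable fun m => ‖m‖ ^ k * ‖a m‖ := by
  obtain ⟨n, hn⟩ := exists_summable_norm_inv_pow ι
  obtain ⟨C, hC⟩ := ha (k + n)
  refine Summable.of_norm_bounded_eventually (hn.mul_left C) ?_
  refine (finite_singleton (0 : ι → ℤ)).subset fun m hm => ?_
  by_contra h0
  refine hm ?_
  have hpos : 0 < ‖m‖ := norm_pos_iff.2 h0
  rw [mem_ofPred_eq, Real.norm_of_nonneg (by positivity), inv_pow, ← div_eq_mul_inv,
    le_div_iff₀ (by positivity)]
  refine le_trans (le_of_eq ?_) (hC m)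
  rw [pow_add]; ring

theorem RapidDecay.summable_norm {a : (ι → ℤ) → E} (ha : RapidDecay a) :
    Summable fun m => ‖a m‖ := by
  simpa using ha.summable_pow_mul 0

theorem RapidDecay.of_norm_le {F : Type} [NormedAddCommGroup F] {a : (ι → ℤ) → E}
    (ha : RapidDecay a) {b : (ι → ℤ) → F}
    {C : ℝ} (hC : 0 ≤ C) (k : ℕ) (hb : ∀ m, ‖b m‖ ≤ C * ‖m‖ ^ k * ‖a m‖) : RapidDecay b := by
  intro N
  obtain ⟨B, hB⟩ := ha (N + k)
  refine ⟨C * B, fun m => ?_⟩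
  calc ‖m‖ ^ N * ‖b m‖ ≤ ‖m‖ ^ N * (C * ‖m‖ ^ k * ‖a m‖) := by gcongr; exact hb m
    _ = C * (‖m‖ ^ (N + k) * ‖a m‖) := by rw [pow_add]; ring
    _ ≤ C * B := by gcongr; exact hB m

theorem RapidDecay.map [NormedSpace ℝ E] {F : Type} [NormedAddCommGroup F] [NormedSpace ℝ F]
    {a : (ι → ℤ) → E} (ha : RapidDecay a)
    (W : E →L[ℝ] F) : RapidDecay fun m => W (a m) :=
  ha.of_norm_le (norm_nonneg W) 0 fun m => by simpa using W.le_opNorm (a m)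

variable [NormedSpace ℂ E]

/-- The sum of the Fourier series with coefficients `a`. -/
def fourierSum (a : (ι → ℤ) → E) (x : ι → ℝ) : E := ∑' m, Complex.exp (freq m x) • a m

theorem fourierSum_add_intCast (a : (ι → ℤ) → E) (x : ι → ℝ) (k : ι → ℤ) :
    fourierSum a (x + fun i => (k i : ℝ)) = fourierSum a x := by
  simp only [fourierSum, exp_freq_add_intCast]

theorem RapidDecay.summable_series [CompleteSpace E] {a : (ι → ℤ) → E} (ha : RapidDecay a)
    (x : ι → ℝ) : Summable fun m => Complex.exp (freq m x) • a m :=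
  Summable.of_norm <| by simpa only [norm_smul, norm_exp_freq, one_mul] using ha.summable_norm

theorem fourierSum_add [CompleteSpace E] {a b : (ι → ℤ) → E} (ha : RapidDecay a) (hb : RapidDecay b)
    (x : ι → ℝ) :
    fourierSum (fun m => a m + b m) x = fourierSum a x + fourierSum b x := by
  simp only [fourierSum, smul_add]
  exact (ha.summable_series x).tsum_add (hb.summable_series x)

variable [NormedSpace ℝ E]

theorem map_fourierSum {F : Type} [NormedAddCommGroup F] [NormedSpace ℝ F] [NormedSpace ℂ F]
    [CompleteSpace E] {a : (ι → ℤ) → E} (ha : RapidDecay a)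
    (W : E →L[ℝ] F) (hW : ∀ (c : ℂ) x, W (c • x) = c • W x) (x : ι → ℝ) :
    W (fourierSum a x) = fourierSum (fun m => W (a m)) x := by
  rw [fourierSum, W.map_tsum (ha.summable_series x)]
  simp only [hW]
  rfl

variable [IsScalarTower ℝ ℂ E]

theorem norm_freq_smulRight_le (m : ι → ℤ) (a : E) :
    ‖(freq m).smulRight a‖ ≤ Fintype.card ι * (2 * Real.pi) * ‖m‖ * ‖a‖ := by
  refine ContinuousLinearMap.opNorm_le_bound _ (by positivity) fun v => ?_
  rw [ContinuousLinearMap.smulRight_apply, norm_smul]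
  calc ‖freq m v‖ * ‖a‖ ≤ (Fintype.card ι * (2 * Real.pi) * ‖m‖ * ‖v‖) * ‖a‖ := by
        gcongr; exact (freq m).le_of_opNorm_le (norm_freq_le m) v
    _ = _ := by ring

theorem RapidDecay.freq_smulRight {a : (ι → ℤ) → E} (ha : RapidDecay a) :
    RapidDecay fun m => (freq m).smulRight (a m) :=
  ha.of_norm_le (C := Fintype.card ι * (2 * Real.pi)) (by positivity) 1 fun m => by
    simpa using norm_freq_smulRight_le m (a m)

theorem hasFDerivAt_fourierSum [CompleteSpace E] {a : (ι → ℤ) → E} (ha : RapidDecay a)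
    (x : ι → ℝ) :
    HasFDerivAt (fourierSum a) (fourierSum (fun m => (freq m).smulRight (a m)) x) x := by
  refine hasFDerivAt_tsum (𝕜 := ℝ) (f := fun m y => Complex.exp (freq m y) • a m)
    (f' := fun m y => Complex.exp (freq m y) • (freq m).smulRight (a m)) (x₀ := x)
    (u := fun m => ‖(freq m).smulRight (a m)‖)
    ha.freq_smulRight.summable_norm (fun m y => ?_) (fun m y => ?_) (ha.summable_series x) x
  · refine ((hasFDerivAt_exp_freq m y).smul_const (a m)).congr_fderiv ?_
    ext v
    simp [smul_smul]
  · rw [norm_smul, norm_exp_freq, one_mul]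

/-- A Fourier series with rapidly decreasing coefficients has a smooth sum. -/
theorem contDiff_fourierSum [CompleteSpace E] {a : (ι → ℤ) → E} (ha : RapidDecay a) :
    ContDiff ℝ ∞ (fourierSum a) := by
  rw [contDiff_infty]
  intro N
  induction N generalizing E with
  | zero =>
    exact contDiff_zero.2 (continuous_iff_continuousAt.2 fun x =>
      (hasFDerivAt_fourierSum ha x).continuousAt)
  | succ N ih =>
    push_cast
    refine contDiff_succ_iff_fderiv.2 ⟨fun x => (hasFDerivAt_fourierSum ha x).differentiableAt,
      by simp, ?_⟩
    rw [show fderiv ℝ (fourierSum a) = fourierSum fun m => (freq m).smulRight (a m) from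
      funext fun x => (hasFDerivAt_fourierSum ha x).fderiv]
    exact ih ha.freq_smulRight

/-- The Fourier coefficients agree with those of Mathlib for the Haar measure on the torus. -/
theorem coef_eq_mFourierCoeff {H : UnitAddTorus ι → ℂ} {h : (ι → ℝ) → ℂ}
    (hH : ∀ x : ι → ℝ, H (fun i => (x i : UnitAddCircle)) = h x) :
    coef h = UnitAddTorus.mFourierCoeff H := by
  funext m
  rw [UnitAddTorus.mFourierCoeff_eq_integral _ _ 0]
  simp only [hH, ← exp_freq_eq_mFourier]
  rfl

theorem fourierSum_coef_complex {h : (ι → ℝ) → ℂ} (hp : IsIntPeriodic h) (hd : ContDiff ℝ ∞ h)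
    (x : ι → ℝ) : fourierSum (coef h) x = h x := by
  obtain ⟨H, hH⟩ := hp.exists_torus
  have hq : IsOpenQuotientMap (Pi.map fun (_ : ι) (t : ℝ) => (t : UnitAddCircle)) :=
    .piMap fun _ => QuotientAddGroup.isOpenQuotientMap_mk
  have hc : Continuous H := by
    refine hq.isQuotientMap.continuous_iff.2 ?_
    exact hd.continuous.congr fun x => (hH x).symm
  have h1 := UnitAddTorus.hasSum_mFourier_series_apply_of_summable (f := ⟨H, hc⟩)
    (by
      rw [ContinuousMap.coe_mk, ← coef_eq_mFourierCoeff hH]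
      exact (rapidDecay_coef hp hd).summable_norm.of_norm) fun i => (x i : UnitAddCircle)
  rw [ContinuousMap.coe_mk, ← coef_eq_mFourierCoeff hH, hH] at h1
  rw [← h1.tsum_eq, fourierSum]
  simp only [← exp_freq_eq_mFourier, smul_eq_mul, mul_comm]

/-- A smooth periodic function is the sum of its Fourier series. -/
theorem fourierSum_coef [CompleteSpace E] {h : (ι → ℝ) → E} (hp : IsIntPeriodic h)
    (hd : ContDiff ℝ ∞ h) (x : ι → ℝ) : fourierSum (coef h) x = h x := by
  refine (SeparatingDual.eq_iff_forall_dual_eq (R := ℂ)).2 fun φ => ?_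
  have hW : ∀ (c : ℂ) x, φ.restrictScalars ℝ (c • x) = c • φ.restrictScalars ℝ x :=
    fun c x => φ.map_smul c x
  have h1 := map_fourierSum (rapidDecay_coef hp hd) (φ.restrictScalars ℝ) hW x
  simp only [← coef_comp hd.continuous (φ.restrictScalars ℝ) hW] at h1
  refine h1.trans (fourierSum_coef_complex (fun x k => ?_) ?_ x)
  · simp only [hp x k]
  · exact (φ.restrictScalars ℝ).contDiff.comp hd

end Series

/-! ### Exterior product and contraction with forms of type (0, 1) -/

section Algebra

open ContinuousAlternatingMap

variable {n k : ℕ}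

/-- The exterior product `A ∧ a` of a form `A` of degree one with a form `a`. -/
def wedge (A : Cn n →L[ℝ] ℂ) (a : Alt n k) : Alt n (k + 1) :=
  alternatizeUncurryFin (A.smulRight a)

theorem wedge_apply (A : Cn n →L[ℝ] ℂ) (a : Alt n k) (v : Fin (k + 1) → Cn n) :
    wedge A a v = ∑ i : Fin (k + 1), (-1) ^ (i : ℕ) * (A (v i) * a (i.removeNth v)) := by
  rw [wedge, alternatizeUncurryFin_apply]
  simp

theorem antilinearPart_smulRight (A : Cn n →L[ℝ] ℂ) (a : Alt n k) :
    antilinearPart _ (A.smulRight a) = (antilinearPart ℂ A).smulRight a := by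
  ext1 v
  simp only [antilinearPart_apply, ContinuousLinearMap.smulRight_apply, smul_eq_mul]
  module

/-- Contraction of `a` with the component of type `(0, 1)` of the vector `w`. -/
def contract (w : Cn n) (a : Alt n (k + 1)) : Alt n k :=
  antilinearPart _ a.curryLeft w

theorem contract_apply (w : Cn n) (a : Alt n (k + 1)) (v : Fin k → Cn n) :
    contract w a v =
      (1 / 2 : ℂ) * (a (Matrix.vecCons w v) + Complex.I * a (Matrix.vecCons (Complex.I • w) v)) := by
  rw [contract, antilinearPart_apply]
  rfl

theorem norm_contract_le (w : Cn n) (a : Alt n (k + 1)) :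
    ‖contract w a‖ ≤ ‖antilinearPart (n := n) (Alt n k)‖ * ‖w‖ * ‖a‖ := by
  have h := (antilinearPart _ a.curryLeft).le_of_opNorm_le
    ((antilinearPart (Alt n k)).le_opNorm a.curryLeft) w
  rw [norm_curryLeft] at h
  exact h.trans_eq (by ring)

/-- The homotopy formula for the contraction `a.curryLeft u` with a real vector `u`. -/
theorem wedge_vecCons (A : Cn n →L[ℝ] ℂ) (a : Alt n (k + 1)) (u : Cn n)
    (v : Fin (k + 1) → Cn n) :
    wedge A a (Matrix.vecCons u v) = A u * a v - wedge A (a.curryLeft u) v := by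
  rw [wedge_apply, wedge_apply, Fin.sum_univ_succ, sub_eq_add_neg, ← Finset.sum_neg_distrib]
  congr 1
  · have : Fin.removeNth 0 (Matrix.vecCons u v) = v := rfl
    simp [this]
  · refine Finset.sum_congr rfl fun i _ => ?_
    have : i.succ.removeNth (Matrix.vecCons u v) = Matrix.vecCons u (i.removeNth v) := by
      funext j
      refine Fin.cases rfl (fun j => ?_) j
      simp [Fin.removeNth]
    rw [this, curryLeft_apply_apply, Fin.val_succ, Matrix.cons_val_succ, pow_succ]
    ring

/-- The homotopy formula: contraction with the `(0, 1)`-part of `w` is an antiderivation for the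
exterior product with forms of degree one. -/
theorem wedge_contract (A : Cn n →L[ℝ] ℂ) (w : Cn n) (a : Alt n (k + 1)) :
    wedge A (contract w a) = (antilinearPart ℂ A w) • a - contract w (wedge A a) := by
  ext v
  have h : wedge A (contract w a) v = (1 / 2 : ℂ) * (wedge A (a.curryLeft w) v +
      Complex.I * wedge A (a.curryLeft (Complex.I • w)) v) := by
    rw [wedge_apply, wedge_apply, wedge_apply, Finset.mul_sum, ← Finset.sum_add_distrib,
      Finset.mul_sum]
    refine Finset.sum_congr rfl fun i _ => ?_
    rw [contract_apply, curryLeft_apply_apply, curryLeft_apply_apply]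
    ring
  rw [h, ContinuousAlternatingMap.sub_apply, ContinuousAlternatingMap.smul_apply, contract_apply,
    wedge_vecCons, wedge_vecCons, antilinearPart_apply, smul_eq_mul, smul_eq_mul, smul_eq_mul]
  ring

/-- The operator `antilinearPart` is a projection. -/
theorem antilinearPart_antilinearPart (A : Cn n →L[ℝ] ℂ) :
    antilinearPart ℂ (antilinearPart ℂ A) = antilinearPart ℂ A := by
  ext v
  rw [antilinearPart_apply, antilinearPart_smul, Complex.conj_I, smul_eq_mul, smul_eq_mul,
    smul_eq_mul]
  linear_combination (-(1 / 2) * antilinearPart ℂ A v) * Complex.I_mul_I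

/-- As `contract w a` is conjugate linear in `w`, contraction divides the character
`c ^ p * c̄ ^ q` by `c̄`. The formula avoids this division, so that it also covers `q = 0`. -/
theorem contract_smul {p q : ℕ} {a : Alt n (k + 1)} (ha : IsType p q a) (w : Cn n) (c : ℂ)
    (v : Fin k → Cn n) :
    starRingEnd ℂ c * contract w a (fun i => c • v i) =
      c ^ p * starRingEnd ℂ c ^ q * contract w a v := by
  have h1 : starRingEnd ℂ c • contract w a = contract (c • w) a :=
    (antilinearPart_smul a.curryLeft c w).symm
  have h2 : ∀ u : Cn n, Matrix.vecCons (c • u) (fun i => c • v i) =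
      fun i => c • (Matrix.vecCons u v : Fin (k + 1) → Cn n) i := fun u => by
    funext j
    refine Fin.cases rfl (fun j => rfl) j
  rw [← smul_eq_mul, ← ContinuousAlternatingMap.smul_apply, h1, contract_apply, contract_apply,
    smul_comm, h2, h2, ha, ha]
  ring

/-- Contraction with a vector of type `(0, 1)` lowers the second degree of a form. -/
theorem isType_contract {p q : ℕ} {a : Alt n (p + q + 1)} (ha : IsType p (q + 1) a) (w : Cn n) :
    IsType p q (contract w a) := by
  intro c v
  rcases eq_or_ne c 0 with rfl | hc
  -- for `c = 0` both sides vanish, except in degree `0`, where there are no vectors to scale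
  · rcases Nat.eq_zero_or_pos (p + q) with h0 | h0
    · obtain ⟨rfl, rfl⟩ : p = 0 ∧ q = 0 := by omega
      simp only [pow_zero, one_mul]
      exact congrArg _ (funext fun i => i.elim0)
    · have h1 : (0 : ℂ) ^ p * starRingEnd ℂ 0 ^ q = 0 := by
        rw [_root_.map_zero, ← pow_add, zero_pow h0.ne']
      rw [h1, zero_mul]
      exact (contract w a).map_coord_zero ⟨0, h0⟩ (zero_smul _ _)
  · have h1 := contract_smul ha w c v
    have h2 : starRingEnd ℂ c ≠ 0 := by simpa using hc
    refine mul_left_cancel₀ h2 (h1.trans ?_)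
    ring

/-- The contraction of a form of type `(p, 0)` with a vector of type `(0, 1)` vanishes: it would have
the character `c ^ p / c̄`, which is not polynomial in the real and imaginary parts of `c`. -/
theorem contract_eq_zero {a : Alt n (k + 1)} (ha : IsType (k + 1) 0 a) (w : Cn n) :
    contract w a = 0 := by
  classical
  ext v
  set b := contract w a
  let P : Polynomial ℂ := ∑ s : Finset (Fin k),
    Polynomial.X ^ s.card * Polynomial.C (b (s.piecewise v fun i => Complex.I • v i))
  -- `P` is the polynomial `t ↦ b ((t + i) v)`
  have hP : ∀ t : ℝ, P.eval (t : ℂ) = b fun i => ((t : ℂ) + Complex.I) • v i := fun t => by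
    have h1 : (fun i => ((t : ℂ) + Complex.I) • v i) =
        (fun i => t • v i) + fun i => Complex.I • v i := by
      funext i
      simp [add_smul]
    have h2 := b.toMultilinearMap.map_add_univ (fun i => t • v i) fun i => Complex.I • v i
    rw [h1]
    refine Eq.trans ?_ h2.symm
    rw [Polynomial.eval_finsetSum]
    refine Finset.sum_congr rfl fun s _ => ?_
    have h3 := b.toMultilinearMap.map_piecewise_smul (fun _ => t)
      (s.piecewise v fun i => Complex.I • v i) s
    have h4 : s.piecewise (fun i => t • s.piecewise v (fun i => Complex.I • v i) i)
        (s.piecewise v fun i => Complex.I • v i) =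
        s.piecewise (fun i => t • v i) fun i => Complex.I • v i := by
      funext i
      by_cases hi : i ∈ s <;> simp [hi]
    rw [h4, Finset.prod_const] at h3
    rw [h3, Polynomial.eval_mul, Polynomial.eval_pow, Polynomial.eval_X, Polynomial.eval_C]
    simp only [Complex.real_smul, Complex.ofReal_pow]
    rfl
  have hQ : (Polynomial.X - Polynomial.C Complex.I) * P =
      (Polynomial.X + Polynomial.C Complex.I) ^ (k + 1) * Polynomial.C (b v) := by
    refine Polynomial.eq_of_infinite_eval_eq _ _
      ((Set.infinite_range_of_injective Complex.ofReal_injective).mono ?_)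
    rintro _ ⟨t, rfl⟩
    have h := contract_smul ha w ((t : ℂ) + Complex.I) v
    simpa [hP, sub_eq_add_neg] using h
  -- at `t = i` the left hand side vanishes and the right hand side does not, unless `b v = 0`
  have h := congrArg (Polynomial.eval Complex.I) hQ
  simpa [← two_mul] using h

/-- Exactness of the Koszul complex of `A^{0,1} ≠ 0`: a form `a` of positive degree with
`A^{0,1} ∧ a = 0` is the product of `A^{0,1}` with a contraction of `a`. -/
theorem wedge_contract_eq {A : Cn n →L[ℝ] ℂ} {w : Cn n} (hw : antilinearPart ℂ A w = 1)
    {a : Alt n (k + 1)} (ha : wedge (antilinearPart ℂ A) a = 0) :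
    wedge (antilinearPart ℂ A) (contract w a) = a := by
  have h0 : contract w (0 : Alt n (k + 1 + 1)) = 0 := by
    ext v
    simp [contract_apply]
  rw [wedge_contract, antilinearPart_antilinearPart, hw, ha, h0, one_smul, sub_zero]

/-- Exterior multiplication by a non-zero form of type `(0, 1)` is injective on the forms of
type `(p, 0)`. -/
theorem eq_zero_of_wedge_eq_zero {A : Cn n →L[ℝ] ℂ} {w : Cn n} (hw : antilinearPart ℂ A w = 1)
    {p : ℕ} {a : Alt n p} (ht : IsType p 0 a) (ha : wedge (antilinearPart ℂ A) a = 0) : a = 0 := by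
  cases p with
  | zero =>
    ext v
    have h := congrArg (fun η : Alt n 1 => η fun _ => w) ha
    simp only [wedge_apply, hw] at h
    rw [Subsingleton.elim v (Fin.removeNth default fun _ => w)]
    simpa using h
  | succ p =>
    rw [← wedge_contract_eq hw ha, contract_eq_zero ht, wedge]
    ext v
    simp [alternatizeUncurryFin_apply]

/-- A vector on which a conjugate linear form takes the value `1`, with a bound. -/
theorem exists_antilinearPart_eq_one {A : Cn n →L[ℝ] ℂ} {δ : ℝ} (hδ : 0 < δ)
    (hA : δ ≤ ‖antilinearPart ℂ A‖) :
    ∃ w, antilinearPart ℂ A w = 1 ∧ ‖w‖ ≤ 2 / δ := by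
  obtain ⟨v, hv1, hv2⟩ := (antilinearPart ℂ A).exists_lt_apply_of_lt_opNorm
    ((half_lt_self hδ).trans_le hA)
  have hpos : 0 < ‖antilinearPart ℂ A v‖ := (half_pos hδ).trans hv2
  have hne : antilinearPart ℂ A v ≠ 0 := norm_pos_iff.1 hpos
  refine ⟨starRingEnd ℂ (antilinearPart ℂ A v)⁻¹ • v, ?_, ?_⟩
  · rw [antilinearPart_smul, Complex.conj_conj, smul_eq_mul, inv_mul_cancel₀ hne]
  · rw [norm_smul, RCLike.norm_conj, norm_inv, inv_mul_le_iff₀ hpos]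
    have h : 1 ≤ ‖antilinearPart ℂ A v‖ * (2 / δ) := by
      rw [mul_div_assoc', le_div_iff₀ hδ]; linarith
    exact hv1.le.trans h

end Algebra

/-! ### Characters, frames and the lattice -/

section LineBundle

variable {n : ℕ} {Γ : Submodule ℤ (Cn n)} {α : AddChar (Cn n) ℂ}

/-- A smooth character of `ℂⁿ` is the exponential of a real linear form, its differential at `0`. -/
theorem exists_eq_exp (hα : ContDiff ℝ ∞ (fun z => α z)) :
    ∃ l : Cn n →L[ℝ] ℂ, ∀ z, α z = Complex.exp (l z) := by
  let l := fderiv ℝ (fun z => α z) 0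
  have hd : ∀ z, HasFDerivAt (fun z => α z) (α z • l) z := fun z => by
    have h1 : HasFDerivAt (fun y => α z * α (y - z)) (α z • l) z := by
      have h2 : HasFDerivAt (fun z => α z) l (z - z) := by
        rw [sub_self]; exact (hα.differentiable (by simp) 0).hasFDerivAt
      exact (HasFDerivAt.comp (f := fun y => y - z) z h2
        ((hasFDerivAt_id z).sub_const z)).const_mul (α z)
    refine h1.congr_of_eventuallyEq (Filter.Eventually.of_forall fun y => ?_)
    simp only [← AddChar.map_add_eq_mul, add_sub_cancel]
  -- so `α` satisfies the differential equation of `exp l`, and `α * exp (-l)` is constant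
  have he : ∀ z, HasFDerivAt (fun z => α z * Complex.exp (-l z)) (0 : Cn n →L[ℝ] ℂ) z := fun z => by
    refine ((hd z).mul l.hasFDerivAt.neg.cexp).congr_fderiv ?_
    ext v
    simp only [add_apply, smul_apply, neg_apply, smul_eq_mul, zero_apply]
    ring
  refine ⟨l, fun z => ?_⟩
  have h := is_const_of_fderiv_eq_zero (𝕜 := ℝ) (fun z => (he z).differentiableAt)
    (fun z => (he z).fderiv) z 0
  simp only [map_zero, neg_zero, Complex.exp_zero, mul_one, AddChar.map_zero_eq_one] at h
  rw [Complex.exp_neg, ← div_eq_mul_inv, div_eq_one_iff_eq (Complex.exp_ne_zero _)] at h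
  exact h

theorem frame_symm_frame {x : Torus Γ} (z w : Cn n) (hz : proj Γ z = x) (hw : proj Γ w = x)
    (v : ℂ) : (frame α w hw).symm (frame α z hz v) = α (w - z) * v := by
  obtain ⟨γ, hγ, rfl⟩ := exists_mem_of_proj_eq (hz.trans hw.symm)
  rw [frame_symm_add α z γ hγ hz hw, ContinuousLinearEquiv.symm_apply_apply, add_sub_cancel_left]

/-- If the character `α` agrees on `Γ` with the exponential of a complex linear form, then this
exponential is a nowhere vanishing holomorphic section, and `L_α` is trivial. -/
theorem isHolomorphicallyTrivial_of_antilinearPart_eq_zero {A : Cn n →L[ℝ] ℂ}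
    (hA : antilinearPart ℂ A = 0) (hα : ∀ γ ∈ Γ, α γ = Complex.exp (A γ)) :
    IsHolomorphicallyTrivial Γ α := by
  have hI : ∀ v, A (Complex.I • v) = Complex.I * A v := fun v => by
    have h := congrArg (fun L : Cn n →L[ℝ] ℂ => L v) hA
    simp only [antilinearPart_apply, smul_eq_mul, zero_apply] at h
    linear_combination (-2 * Complex.I) * h + A (Complex.I • v) * Complex.I_mul_I
  let A' : Cn n →L[ℂ] ℂ :=
    { toFun := A
      map_add' := A.map_add
      map_smul' := fun c v => by
        have h : c • v = c.re • v + c.im • (Complex.I • v) := by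
          conv_lhs => rw [← Complex.re_add_im c]
          rw [add_smul, mul_smul]; rfl
        rw [h, map_add, A.map_smul, A.map_smul, hI, RingHom.id_apply, smul_eq_mul,
          Complex.real_smul, Complex.real_smul]
        linear_combination A v * Complex.re_add_im c
      cont := A.cont }
  refine ⟨fun x => (frame α (rep x) (proj_rep x)).symm.toLinearEquiv.trans
    (LinearEquiv.smulOfNeZero ℂ ℂ (Complex.exp (-A (rep x))) (Complex.exp_ne_zero _)), ?_⟩
  have h : ∀ a : Cn n × ℂ, Complex.exp (-A (rep (proj Γ a.1))) •
      (frame α (rep (proj Γ a.1)) (proj_rep _)).symm (frame α a.1 rfl a.2) =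
      Complex.exp (-A' a.1) * a.2 := fun a => by
    have hγ : rep (proj Γ a.1) - a.1 ∈ Γ :=
      (Submodule.Quotient.eq Γ).1 (proj_rep (proj Γ a.1))
    rw [frame_symm_frame, hα _ hγ, smul_eq_mul, ← mul_assoc, ← Complex.exp_add, map_sub]
    congr 2
    show -A _ + (A _ - A _) = -A _
    ring
  refine Eq.mpr (congrArg (Differentiable ℂ) (funext h)) ?_
  fun_prop

/-- Every `Γ`-equivariant form on `ℂⁿ` is the pull-back of an `L_α`-valued form. -/
theorem exists_lift_eq {k : ℕ} {u : Cn n → Alt n k}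
    (hu : ∀ z, ∀ γ ∈ Γ, u (z + γ) = α γ • u z) : ∃ η : BundleForm Γ α k, lift α η = u := by
  let η : BundleForm Γ α k := fun x =>
    ((frame α (rep x) (proj_rep x)).toContinuousLinearMap.restrictScalars
      ℝ).compContinuousAlternatingMap (u (rep x))
  refine ⟨η, ?_⟩
  funext z
  ext v
  rw [lift_apply, ContinuousLinearEquiv.symm_apply_eq]
  obtain ⟨γ, hγ, h⟩ := exists_mem_of_proj_eq (proj_rep (proj Γ z)).symm
  have key : ∀ (w : Cn n) (hw : proj Γ w = proj Γ z), w = z + γ →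
      frame α w hw (u w v) = frame α z rfl (u z v) := by
    rintro w hw rfl
    rw [hu z γ hγ, ContinuousAlternatingMap.smul_apply, smul_eq_mul, frame_apply, frame_apply,
      frameFun_add α z γ hγ rfl hw]
  exact key _ (proj_rep (proj Γ z)) h

/-- Real coordinates on `ℂⁿ` in which the lattice is `ℤ^ι`. -/
theorem exists_lattice_coordinates (Γ : Submodule ℤ (Cn n)) [DiscreteTopology Γ] [IsZLattice ℝ Γ] :
    ∃ (ι : Type) (_ : Fintype ι) (B : Cn n ≃L[ℝ] (ι → ℝ)),
      (∀ γ ∈ Γ, ∃ k : ι → ℤ, B γ = fun i => (k i : ℝ)) ∧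
      ∀ k : ι → ℤ, B.symm (fun i => (k i : ℝ)) ∈ Γ := by
  have : Module.Finite ℤ Γ := ZLattice.module_finite ℝ Γ
  have : Module.Free ℤ Γ := ZLattice.module_free ℝ Γ
  let b := Module.Free.chooseBasis ℤ Γ
  let B := (b.ofZLatticeBasis ℝ Γ).equivFun.toContinuousLinearEquiv
  refine ⟨Module.Free.ChooseBasisIndex ℤ Γ, inferInstance, B, fun γ hγ => ?_, fun k => ?_⟩
  · refine ⟨fun i => b.repr ⟨γ, hγ⟩ i, funext fun i => ?_⟩
    exact b.ofZLatticeBasis_repr_apply ℝ Γ ⟨γ, hγ⟩ i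
  · have h : B.symm (fun i => (k i : ℝ)) = ∑ i, k i • (b i : Cn n) := by
      show (b.ofZLatticeBasis ℝ Γ).equivFun.symm _ = _
      rw [Module.Basis.equivFun_symm_apply]
      refine Finset.sum_congr rfl fun i _ => ?_
      rw [b.ofZLatticeBasis_apply ℝ Γ, Int.cast_smul_eq_zsmul]
    rw [h]
    exact Submodule.sum_mem _ fun i _ => Γ.smul_mem _ (b i).2

end LineBundle

/-! ### The action of the Dolbeault operator on Fourier coefficients -/

section Symbol

variable {n k : ℕ} {ι : Type} [Fintype ι]

theorem norm_le_norm_freq (m : ι → ℤ) : ‖m‖ ≤ ‖freq m‖ := by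
  have h : (freq m).smulRight (1 : ℂ) = freq m := by ext; simp
  simpa [h] using norm_mul_le_norm_freq_smulRight m (1 : ℂ)

/-- A real linear form with imaginary values is controlled by its conjugate linear part, as its
imaginary part is twice that of the latter. -/
theorem norm_freq_comp_le (B : Cn n ≃L[ℝ] (ι → ℝ)) (m : ι → ℤ) :
    ‖m‖ ≤ 2 * ‖(B.symm : (ι → ℝ) →L[ℝ] Cn n)‖ *
      ‖antilinearPart ℂ ((freq m).comp (B : Cn n →L[ℝ] (ι → ℝ)))‖ := by
  refine (norm_le_norm_freq m).trans
    (ContinuousLinearMap.opNorm_le_bound _ (by positivity) fun x => ?_)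
  set A := (freq m).comp (B : Cn n →L[ℝ] (ι → ℝ))
  have h1 : ‖freq m x‖ ≤ 2 * ‖antilinearPart ℂ A (B.symm x)‖ := by
    have h2 : freq m x = A (B.symm x) := by simp [A]
    have h3 : ∀ z, (A z).re = 0 := fun z => freq_re m _
    have h4 : (antilinearPart ℂ A (B.symm x)).im = (A (B.symm x)).im / 2 := by
      have : antilinearPart ℂ A (B.symm x) =
        ((1 / 2 : ℝ) : ℂ) * (A (B.symm x) + Complex.I * A (Complex.I • B.symm x)) := by
          rw [antilinearPart_apply]; push_cast; rfl
      rw [this, Complex.im_ofReal_mul, Complex.add_im, Complex.I_mul_im, h3]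
      ring
    have h5 : ‖A (B.symm x)‖ = |(A (B.symm x)).im| := by
      rw [← Complex.abs_im_eq_norm.2 (h3 _)]
    have h6 := Complex.abs_im_le_norm (antilinearPart ℂ A (B.symm x))
    rw [h4, abs_div, abs_two] at h6
    rw [h2, h5]
    linarith
  calc ‖freq m x‖ ≤ 2 * ‖antilinearPart ℂ A (B.symm x)‖ := h1
    _ ≤ 2 * (‖antilinearPart ℂ A‖ * (‖(B.symm : (ι → ℝ) →L[ℝ] Cn n)‖ * ‖x‖)) := by
        gcongr
        exact (antilinearPart ℂ A).le_opNorm_of_le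
          ((B.symm : (ι → ℝ) →L[ℝ] Cn n).le_opNorm x)
    _ = _ := by ring

/-- The sum of `l` and the pull-back of `freq m` under the coordinates `B`. Its exponential is the
product of `exp l` with the `m`-th character of `ℂⁿ/Γ`. -/
def expForm (l : Cn n →L[ℝ] ℂ) (B : Cn n ≃L[ℝ] (ι → ℝ)) (m : ι → ℤ) : Cn n →L[ℝ] ℂ :=
  l + (freq m).comp (B : Cn n →L[ℝ] (ι → ℝ))

/-- The conjugate linear parts of the forms `expForm l B m` tend to infinity with `m`, so that they
are bounded below as soon as none of them vanishes. -/
theorem exists_le_norm_antilinearPart {l : Cn n →L[ℝ] ℂ} {B : Cn n ≃L[ℝ] (ι → ℝ)}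
    (h : ∀ m, antilinearPart ℂ (expForm l B m) ≠ 0) :
    ∃ δ > 0, ∀ m, δ ≤ ‖antilinearPart ℂ (expForm l B m)‖ := by
  have h1 : Filter.Tendsto (fun m : ι → ℤ => ‖m‖) Filter.cofinite Filter.atTop := by
    rw [← Filter.cocompact_eq_cofinite]
    exact tendsto_norm_cocompact_atTop
  set C := 2 * ‖(B.symm : (ι → ℝ) →L[ℝ] Cn n)‖ + 1
  have hC0 : 0 < C := by positivity
  have h2 : Filter.Tendsto (fun m => ‖antilinearPart ℂ (expForm l B m)‖) Filter.cofinite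
      Filter.atTop := by
    refine Filter.tendsto_atTop_mono (fun m => ?_)
      (Filter.tendsto_atTop_add_const_right _ (-‖antilinearPart ℂ l‖)
        (h1.const_mul_atTop (inv_pos.2 hC0)))
    have h3 : ‖antilinearPart ℂ ((freq m).comp (B : Cn n →L[ℝ] (ι → ℝ)))‖ ≤
        ‖antilinearPart ℂ (expForm l B m)‖ + ‖antilinearPart ℂ l‖ := by
      have : antilinearPart ℂ ((freq m).comp (B : Cn n →L[ℝ] (ι → ℝ))) =
          antilinearPart ℂ (expForm l B m) - antilinearPart ℂ l := by
        rw [expForm, map_add, add_sub_cancel_left]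
      rw [this]
      exact norm_sub_le _ _
    have h4 : C⁻¹ * ‖m‖ ≤ ‖antilinearPart ℂ ((freq m).comp (B : Cn n →L[ℝ] (ι → ℝ)))‖ := by
      rw [inv_mul_le_iff₀ hC0]
      refine (norm_freq_comp_le B m).trans ?_
      gcongr
      linarith
    linarith
  -- the minimum of the norms is attained, and is positive
  obtain ⟨m₀, hm₀⟩ := h2.exists_forall_le
  exact ⟨_, norm_pos_iff.2 (h m₀), hm₀⟩

variable (n k) in
/-- The operator on differentials of coefficients that defines `∂̄` on forms. -/
def dbarSymbol : (Cn n →L[ℝ] Alt n k) →L[ℝ] Alt n (k + 1) :=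
  (ContinuousAlternatingMap.alternatizeUncurryFinCLM ℝ (Cn n) ℂ).comp (antilinearPart (Alt n k))

theorem dbarSymbol_smul (c : ℂ) (L : Cn n →L[ℝ] Alt n k) :
    dbarSymbol n k (c • L) = c • dbarSymbol n k L :=
  dbarAux_smul c L

theorem dbarSymbol_smulRight (A : Cn n →L[ℝ] ℂ) (a : Alt n k) :
    dbarSymbol n k (A.smulRight a) = wedge (antilinearPart ℂ A) a :=
  congrArg _ (antilinearPart_smulRight A a)

/-- Exterior product with the conjugate linear part of `l`, as a continuous linear map. -/
def wedgeCLM (l : Cn n →L[ℝ] ℂ) (k : ℕ) : Alt n k →L[ℝ] Alt n (k + 1) :=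
  (dbarSymbol n k).comp
    (((ContinuousLinearMap.compL ℝ (Cn n) ℂ (Alt n k)).flip l).comp
      (ContinuousLinearMap.lsmul ℝ ℂ).flip)

theorem wedgeCLM_apply (l : Cn n →L[ℝ] ℂ) (a : Alt n k) :
    wedgeCLM l k a = dbarSymbol n k (l.smulRight a) := rfl

theorem wedgeCLM_smul (l : Cn n →L[ℝ] ℂ) (c : ℂ) (a : Alt n k) :
    wedgeCLM l k (c • a) = c • wedgeCLM l k a := by
  rw [wedgeCLM_apply, wedgeCLM_apply, ← dbarSymbol_smul]
  congr 1
  ext1 v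
  simp only [ContinuousLinearMap.smulRight_apply, smul_apply, smul_comm c]

/-- The operator `dbarSymbol` in the real coordinates `B`. -/
def dbarCoord (B : Cn n ≃L[ℝ] (ι → ℝ)) (k : ℕ) : ((ι → ℝ) →L[ℝ] Alt n k) →L[ℝ] Alt n (k + 1) :=
  (dbarSymbol n k).comp
    ((ContinuousLinearMap.compL ℝ (Cn n) (ι → ℝ) (Alt n k)).flip (B : Cn n →L[ℝ] (ι → ℝ)))

theorem dbarCoord_apply (B : Cn n ≃L[ℝ] (ι → ℝ)) (L : (ι → ℝ) →L[ℝ] Alt n k) :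
    dbarCoord B k L = dbarSymbol n k (L.comp (B : Cn n →L[ℝ] (ι → ℝ))) := rfl

theorem dbarCoord_smul (B : Cn n ≃L[ℝ] (ι → ℝ)) (c : ℂ) (L : (ι → ℝ) →L[ℝ] Alt n k) :
    dbarCoord B k (c • L) = c • dbarCoord B k L := by
  rw [dbarCoord_apply, dbarCoord_apply, ← dbarSymbol_smul]
  rfl

theorem wedgeCLM_add_dbarCoord (l : Cn n →L[ℝ] ℂ) (B : Cn n ≃L[ℝ] (ι → ℝ)) (m : ι → ℤ)
    (a : Alt n k) : wedgeCLM l k a + dbarCoord B k ((freq m).smulRight a) =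
      wedge (antilinearPart ℂ (expForm l B m)) a := by
  rw [wedgeCLM_apply, dbarCoord_apply, ← map_add, ← dbarSymbol_smulRight]
  congr 1
  ext1 v
  simp [expForm, add_smul]

/-- After division by `exp l`, the operator `∂̄` becomes `∂̄ + l^{0,1} ∧`. -/
theorem dbarCn_exp_smul (l : Cn n →L[ℝ] ℂ) (B : Cn n ≃L[ℝ] (ι → ℝ)) {g : (ι → ℝ) → Alt n k}
    (hg : Differentiable ℝ g) (z : Cn n) :
    dbarCn (fun z => Complex.exp (l z) • g (B z)) z =
      Complex.exp (l z) • (wedgeCLM l k (g (B z)) + dbarCoord B k (fderiv ℝ g (B z))) := by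
  have h1 : HasFDerivAt (fun z => g (B z)) ((fderiv ℝ g (B z)).comp (B : Cn n →L[ℝ] (ι → ℝ))) z :=
    (hg (B z)).hasFDerivAt.comp z B.hasFDerivAt
  have h2 := (l.hasFDerivAt (x := z)).cexp.smul h1
  have h3 : fderiv ℝ (fun z => Complex.exp (l z) • g (B z)) z = Complex.exp (l z) •
      (l.smulRight (g (B z)) + (fderiv ℝ g (B z)).comp (B : Cn n →L[ℝ] (ι → ℝ))) := by
    refine (show fderiv ℝ (fun z => Complex.exp (l z) • g (B z)) z = _ from h2.fderiv).trans ?_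
    ext1 v
    simp only [add_apply, smul_apply, ContinuousLinearMap.smulRight_apply]
    module
  rw [wedgeCLM_apply, dbarCoord_apply, ← map_add, ← dbarSymbol_smul, ← h3]
  rfl

theorem isType_coef {p q : ℕ} {g : (ι → ℝ) → Alt n k} (hg : Continuous g)
    (ht : ∀ x, IsType p q (g x)) (m : ι → ℤ) : IsType p q (coef g m) := by
  intro c v
  have h := coef_comp hg (ContinuousAlternatingMap.apply ℝ (Cn n) ℂ fun i => c • v i)
    (fun _ _ => rfl) m
  have h' := coef_comp hg ((c ^ p * starRingEnd ℂ c ^ q) •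
    ContinuousAlternatingMap.apply ℝ (Cn n) ℂ v) (fun b x => by
      simp only [smul_apply, ContinuousAlternatingMap.apply_apply,
        ContinuousAlternatingMap.smul_apply, smul_eq_mul]
      ring) m
  refine h.symm.trans (Eq.trans (congrArg (coef · m) (funext fun x => ?_)) h')
  exact ht x c v

theorem isType_fourierSum {p q : ℕ} {a : (ι → ℤ) → Alt n k} (ha : RapidDecay a)
    (ht : ∀ m, IsType p q (a m)) (x : ι → ℝ) : IsType p q (fourierSum a x) := by
  intro c v
  have h := map_fourierSum ha (ContinuousAlternatingMap.apply ℝ (Cn n) ℂ fun i => c • v i)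
    (fun _ _ => rfl) x
  have h' := map_fourierSum ha ((c ^ p * starRingEnd ℂ c ^ q) •
    ContinuousAlternatingMap.apply ℝ (Cn n) ℂ v) (fun b x => by
      simp only [smul_apply, ContinuousAlternatingMap.apply_apply,
        ContinuousAlternatingMap.smul_apply, smul_eq_mul]
      ring) x
  refine h.trans (Eq.trans (congrArg (fourierSum · x) (funext fun m => ?_)) h'.symm)
  exact ht m c v

end Symbol

/-! ### Vanishing of the cohomology -/

section Vanishing

variable {n k : ℕ} {Γ : Submodule ℤ (Cn n)} {α : AddChar (Cn n) ℂ} {ι : Type}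

/-- The periodic function obtained from an `L_α`-valued form through division of its pull-back
to `ℂⁿ` by the nowhere vanishing section `exp l`, in the real coordinates `B`. -/
def periodicPart (l : Cn n →L[ℝ] ℂ) (B : Cn n ≃L[ℝ] (ι → ℝ)) (η : BundleForm Γ α k)
    (x : ι → ℝ) : Alt n k :=
  Complex.exp (-l (B.symm x)) • lift α η (B.symm x)

theorem exp_smul_periodicPart (l : Cn n →L[ℝ] ℂ) (B : Cn n ≃L[ℝ] (ι → ℝ)) (η : BundleForm Γ α k) :
    (fun z => Complex.exp (l z) • periodicPart l B η (B z)) = lift α η := by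
  funext z
  rw [periodicPart, smul_smul, ← Complex.exp_add, B.symm_apply_apply, add_neg_cancel,
    Complex.exp_zero, one_smul]

theorem isIntPeriodic_periodicPart {l : Cn n →L[ℝ] ℂ} {B : Cn n ≃L[ℝ] (ι → ℝ)}
    (hl : ∀ z, α z = Complex.exp (l z)) (hB : ∀ k : ι → ℤ, B.symm (fun i => (k i : ℝ)) ∈ Γ)
    (η : BundleForm Γ α k) : IsIntPeriodic (periodicPart l B η) := by
  intro x m
  rw [periodicPart, map_add, lift_add α η _ _ (hB m), hl, smul_smul, ← Complex.exp_add, map_add,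
    periodicPart]
  congr 2
  ring

theorem isType_smul {p q : ℕ} {a : Alt n k} (ha : IsType p q a) (b : ℂ) : IsType p q (b • a) := by
  intro c v
  rw [ContinuousAlternatingMap.smul_apply, ContinuousAlternatingMap.smul_apply, ha c v, smul_eq_mul,
    smul_eq_mul]
  ring

variable [Fintype ι]

theorem contDiff_periodicPart {l : Cn n →L[ℝ] ℂ} {B : Cn n ≃L[ℝ] (ι → ℝ)} {η : BundleForm Γ α k}
    (hη : ContDiff ℝ ∞ (lift α η)) : ContDiff ℝ ∞ (periodicPart l B η) :=
  (l.contDiff.comp B.symm.contDiff).neg.cexp.smul (hη.comp B.symm.contDiff)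

/-- The Fourier coefficients of a `∂̄`-closed form are annihilated by exterior multiplication by
the conjugate linear parts of the corresponding forms `expForm l B m`. -/
theorem wedge_coef_eq_zero {l : Cn n →L[ℝ] ℂ} {B : Cn n ≃L[ℝ] (ι → ℝ)}
    (hl : ∀ z, α z = Complex.exp (l z)) (hB : ∀ k : ι → ℤ, B.symm (fun i => (k i : ℝ)) ∈ Γ)
    {η : BundleForm Γ α k} (hη : ContDiff ℝ ∞ (lift α η)) (hd : dbarCn (lift α η) = 0)
    (m : ι → ℤ) :
    wedge (antilinearPart ℂ (expForm l B m)) (coef (periodicPart l B η) m) = 0 := by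
  set g := periodicPart l B η
  have hgs : ContDiff ℝ ∞ g := contDiff_periodicPart hη
  have hgp : IsIntPeriodic g := isIntPeriodic_periodicPart hl hB η
  have h1 : ∀ x, dbarCoord B k (fderiv ℝ g x) = -wedgeCLM l k (g x) := fun x => by
    have h := dbarCn_exp_smul l B (hgs.differentiable (by simp)) (B.symm x)
    rw [exp_smul_periodicPart, hd, B.apply_symm_apply] at h
    exact eq_neg_of_add_eq_zero_right
      ((smul_eq_zero.1 h.symm).resolve_left (Complex.exp_ne_zero _))
  have h2 := coef_comp hgs.continuous (wedgeCLM l k) (wedgeCLM_smul l) m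
  have h3 := coef_comp (hgs.continuous_fderiv (by simp)) (dbarCoord B k) (dbarCoord_smul B) m
  rw [coef_fderiv hgp (hgs.of_le (by simp)), funext h1, coef_neg, h2] at h3
  rw [← wedgeCLM_add_dbarCoord, ← h3, add_neg_cancel]

/-- Termwise application of `∂̄` to a Fourier series multiplied by `exp l`. -/
theorem dbarCn_exp_smul_fourierSum (l : Cn n →L[ℝ] ℂ) (B : Cn n ≃L[ℝ] (ι → ℝ))
    {b : (ι → ℤ) → Alt n k} (hb : RapidDecay b) (z : Cn n) :
    dbarCn (fun z => Complex.exp (l z) • fourierSum b (B z)) z = Complex.exp (l z) •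
      fourierSum (fun m => wedge (antilinearPart ℂ (expForm l B m)) (b m)) (B z) := by
  rw [dbarCn_exp_smul l B fun x => (hasFDerivAt_fourierSum hb x).differentiableAt,
    (hasFDerivAt_fourierSum hb _).fderiv, map_fourierSum hb _ (wedgeCLM_smul l),
    map_fourierSum hb.freq_smulRight _ (dbarCoord_smul B),
    ← fourierSum_add (hb.map _) (hb.freq_smulRight.map _)]
  simp only [wedgeCLM_add_dbarCoord]

variable [DiscreteTopology Γ] [IsZLattice ℝ Γ]

/-- The consequences of the hypotheses on which the vanishing of the cohomology rests: `α` is the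
exponential of a linear form `l`, and no `expForm l B m` has conjugate linear part zero. The vectors
`w m` witness the latter; it matters that they are bounded, for contraction of the Fourier
coefficients with them then preserves rapid decay. -/
theorem exists_bounded_vectors (hα : ContDiff ℝ ∞ (fun z => α z))
    (hL : ¬ IsHolomorphicallyTrivial Γ α) :
    ∃ (ι : Type) (_ : Fintype ι) (B : Cn n ≃L[ℝ] (ι → ℝ)) (l : Cn n →L[ℝ] ℂ)
      (w : (ι → ℤ) → Cn n) (C : ℝ),
      (∀ γ ∈ Γ, ∃ k : ι → ℤ, B γ = fun i => (k i : ℝ)) ∧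
      (∀ k : ι → ℤ, B.symm (fun i => (k i : ℝ)) ∈ Γ) ∧ (∀ z, α z = Complex.exp (l z)) ∧
      ∀ m, antilinearPart ℂ (expForm l B m) (w m) = 1 ∧ ‖w m‖ ≤ C := by
  obtain ⟨l, hl⟩ := exists_eq_exp hα
  obtain ⟨ι, _, B, hB1, hB2⟩ := exists_lattice_coordinates Γ
  have h : ∀ m : ι → ℤ, antilinearPart ℂ (expForm l B m) ≠ 0 := fun m hm =>
    hL <| isHolomorphicallyTrivial_of_antilinearPart_eq_zero hm fun γ hγ => by
      obtain ⟨k, hk⟩ := hB1 γ hγ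
      have h1 : expForm l B m γ = l γ + freq m (B γ) := rfl
      rw [hl, h1, Complex.exp_add, hk, exp_freq_intCast, mul_one]
  obtain ⟨δ, hδ, hδ'⟩ := exists_le_norm_antilinearPart h
  choose w hw1 hw2 using fun m => exists_antilinearPart_eq_one hδ (hδ' m)
  exact ⟨ι, _, B, l, w, 2 / δ, hB1, hB2, hl, fun m => ⟨hw1 m, hw2 m⟩⟩

/-- A holomorphic form of type `(p, 0)` with values in a non-trivial `L_α` vanishes. -/
theorem eq_zero_of_dolbeault_eq_zero (hα : ContDiff ℝ ∞ (fun z => α z))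
    (hL : ¬ IsHolomorphicallyTrivial Γ α) {p : ℕ} {η : DolbeaultForms Γ α p 0}
    (hd : dolbeault Γ α p 0 η = 0) : η = 0 := by
  obtain ⟨ι, _, B, l, w, C, -, hB, hl, hw⟩ := exists_bounded_vectors hα hL
  have hd' : dbarCn (lift α η.1) = 0 := by
    rw [← lift_dbar, show dbar α η.1 = 0 from congrArg Subtype.val hd, map_zero]
  have hs : ContDiff ℝ ∞ (periodicPart l B η.1) := contDiff_periodicPart η.2.1
  have h0 : coef (periodicPart l B η.1) = fun _ => 0 := funext fun m =>
    eq_zero_of_wedge_eq_zero (hw m).1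
      (isType_coef hs.continuous (fun x => isType_smul (η.2.2 _) _) m)
      (wedge_coef_eq_zero hl hB η.2.1 hd' m)
  refine Subtype.ext (lift_injective α ?_)
  rw [← exp_smul_periodicPart l B]
  funext z
  rw [← fourierSum_coef (isIntPeriodic_periodicPart hl hB _) hs, h0]
  simp [fourierSum]

/-- A closed form of type `(p, q + 1)` with values in a non-trivial `L_α` is exact. -/
theorem exists_dolbeault_eq (hα : ContDiff ℝ ∞ (fun z => α z))
    (hL : ¬ IsHolomorphicallyTrivial Γ α) {p q : ℕ} {η : DolbeaultForms Γ α p (q + 1)}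
    (hd : dolbeault Γ α p (q + 1) η = 0) : ∃ θ, dolbeault Γ α p q θ = η := by
  obtain ⟨ι, _, B, l, w, C, hB', hB, hl, hw⟩ := exists_bounded_vectors hα hL
  have hd' : dbarCn (lift α η.1) = 0 := by
    rw [← lift_dbar, show dbar α η.1 = 0 from congrArg Subtype.val hd, map_zero]
  have hs : ContDiff ℝ ∞ (periodicPart l B η.1) := contDiff_periodicPart η.2.1
  have hp : IsIntPeriodic (periodicPart l B η.1) := isIntPeriodic_periodicPart hl hB _
  let a : (ι → ℤ) → Alt n (p + q + 1) := coef (periodicPart l B η.1)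
  let b : (ι → ℤ) → Alt n (p + q) := fun m => contract (w m) (a m)
  have hC : 0 ≤ C := (norm_nonneg _).trans (hw 0).2
  have hb : RapidDecay b := (rapidDecay_coef hp hs).of_norm_le
    (C := ‖antilinearPart (n := n) (Alt n (p + q))‖ * C) (by positivity) 0 fun m => by
      rw [pow_zero, mul_one]
      refine (norm_contract_le _ _).trans ?_
      gcongr
      exact (hw m).2
  have hbt : ∀ m, IsType p q (b m) := fun m =>
    isType_contract (isType_coef hs.continuous (fun x => isType_smul (η.2.2 _) _) m) _
  have hab : ∀ m, wedge (antilinearPart ℂ (expForm l B m)) (b m) = a m := fun m =>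
    wedge_contract_eq (hw m).1 (wedge_coef_eq_zero hl hB η.2.1 hd' m)
  obtain ⟨θ, hθ⟩ := exists_lift_eq (Γ := Γ) (α := α)
    (u := fun z => Complex.exp (l z) • fourierSum b (B z)) fun z γ hγ => by
      obtain ⟨m, hm⟩ := hB' γ hγ
      simp only [map_add, hm, fourierSum_add_intCast, hl, smul_smul, Complex.exp_add]
      rw [mul_comm]
  refine ⟨⟨θ, ?_, fun z => ?_⟩, Subtype.ext (lift_injective α ?_)⟩
  · rw [hθ]
    exact l.contDiff.cexp.smul ((contDiff_fourierSum hb).comp B.contDiff)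
  · rw [hθ]
    exact isType_smul (isType_fourierSum hb hbt _) _
  · show lift α (dbar α θ) = lift α η.1
    rw [lift_dbar, hθ]
    funext z
    rw [dbarCn_exp_smul_fourierSum l B hb, funext hab, fourierSum_coef hp hs]
    exact congrFun (exp_smul_periodicPart l B η.1) z

end Vanishing

end ComplexTorus

end

theorem proposition2p4 (n : ℕ) (Γ : Submodule ℤ (Fin n → ℂ)) [DiscreteTopology Γ] [IsZLattice ℝ Γ]
    (α : AddChar (Fin n → ℂ) ℂ) (hα : ContDiff ℝ ∞ (fun z => α z))
    (hL : ¬ ComplexTorus.IsHolomorphicallyTrivial Γ α) (p q : ℕ) :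
    Subsingleton (ComplexTorus.DolbeaultCohomology Γ α p q) := by
  refine Submodule.Quotient.subsingleton_iff.2 (eq_top_iff.2 ?_)
  rintro ⟨η, hη⟩ -
  cases q with
  | zero => exact ComplexTorus.eq_zero_of_dolbeault_eq_zero hα hL hη
  | succ q => exact ComplexTorus.exists_dolbeault_eq hα hL hη
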